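/- Let $k$ be a field, $N\ge 2$, and let $Q$ be the cyclic quiver with vertices $1,\dots,N$ and arrows $\alpha_i\colon i\to i+1$ ($1\le i<N$), $\alpha_N\colon N\to 1$. Let $\Lambda=kQ/\langle \mathrm{REL}\rangle$ be a cyclic Nakayama algebra, i.e. $\mathrm{REL}$ is a nonempty set of paths of $Q$ of length at least $2$. All modules are finitely generated. Let $K_0$ be the abelian group generated by the symbols $[X]$, $X$ a $\Lambda$-module, modulo the relations $[A_1]=[A_2]+[A_3]$ if $A_1\cong A_2\oplus A_3$ and $[P]=0$ if $P$ is projective. Let $L\colon K_0\to K_0$ be the homomorphism $L[M]=[\Omega M]$, where $\Omega M$ is the first syzygy of $M$. For a module $M$ let $\langle \mathrm{add}\,M\rangle\subseteq K_0$ be the subgroup generated by the classes of the indecomposable direct summands of $M$, put $$\varphi(M)=\min\{t\ge 0 \mid \operatorname{rank} L^t\langle \mathrm{add}\,M\rangle=\operatorname{rank} L^{t+j}\langle \mathrm{add}\,M\rangle \text{ for all } j\ge 1\},$$ and let $\varphi\dim\Lambda=\sup_M\varphi(M)$. The algebra $\Lambda$ is called Gorenstein if every injective $\Lambda$-module has finite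 projective dimension, and its Gorenstein dimension $\operatorname{gordim}\Lambda$ is the supremum of the projective dimensions of the injective $\Lambda$-modules. Theorem. If $\Lambda$ is Gorenstein, then $\operatorname{gordim}\Lambda=\varphi\dim\Lambda$. -/

import Mathlib

universe u

/-! ## Homological invariants of a left Noetherian ring -/

namespace Homological

section K0

variable (A : Type u) [Ring A]

/-- The defining relations of `K₀`: `[A₁] = [A₂] + [A₃]` whenever `A₁ ≅ A₂ ⊕ A₃`, and `[P] = 0`
whenever `P` is projective (all modules finitely generated). -/
inductive K0Rel : FreeAbelianGroup (FGModuleCat.{u} A) → Prop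
  | add (X Y Z : FGModuleCat.{u} A) (e : X ≃ₗ[A] Y × Z) :
      K0Rel (FreeAbelianGroup.of X - (FreeAbelianGroup.of Y + FreeAbelianGroup.of Z))
  | proj (P : FGModuleCat.{u} A) (hP : Module.Projective A P) :
      K0Rel (FreeAbelianGroup.of P)

/-- The abelian group `K₀` generated by the symbols `[X]`, `X` a finitely generated `A`-module,
modulo the relations `K0Rel`. -/
abbrev K0 : Type (u + 1) :=
  FreeAbelianGroup (FGModuleCat.{u} A) ⧸ AddSubgroup.closure {x | K0Rel A x}

variable {A}

/-- The symbol `[X]` in `K₀`. -/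
noncomputable def K0.cls (X : FGModuleCat.{u} A) : K0 A :=
  QuotientAddGroup.mk (FreeAbelianGroup.of X)

theorem K0.cls_add {X Y Z : FGModuleCat.{u} A} (e : X ≃ₗ[A] Y × Z) :
    K0.cls X = K0.cls Y + K0.cls Z := by
  have h := (QuotientAddGroup.eq_zero_iff _).2
    (AddSubgroup.subset_closure (k := {x | K0Rel A x}) (K0Rel.add X Y Z e))
  exact sub_eq_zero.1 h

theorem K0.cls_proj (P : FGModuleCat.{u} A) (hP : Module.Projective A P) : K0.cls P = 0 :=
  (QuotientAddGroup.eq_zero_iff _).2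
    (AddSubgroup.subset_closure (k := {x | K0Rel A x}) (K0Rel.proj P hP))

/-- A module is indecomposable if it is nonzero and not the direct sum of two nonzero
submodules. -/
def IsIndecomposable (X : FGModuleCat.{u} A) : Prop :=
  Nontrivial X ∧ ∀ U V : Submodule A X, IsCompl U V → U = ⊥ ∨ V = ⊥

/-- The subgroup `⟨add M⟩` of `K₀` generated by the indecomposable direct summands of `M`. -/
noncomputable def addSpan (M : FGModuleCat.{u} A) : Submodule ℤ (K0 A) :=
  Submodule.span ℤ {x | ∃ X Y : FGModuleCat.{u} A,
    IsIndecomposable X ∧ Nonempty (M ≃ₗ[A] X × Y) ∧ x = K0.cls X}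

/-- A surjection onto a projective module splits. -/
theorem nonempty_equiv_ker_prod {X P : Type u} [AddCommGroup X] [Module A X] [AddCommGroup P]
    [Module A P] [Module.Projective A P] (f : X →ₗ[A] P) (hf : Function.Surjective f) :
    Nonempty (X ≃ₗ[A] LinearMap.ker f × P) := by
  obtain ⟨s, hs⟩ := Module.projective_lifting_property f LinearMap.id hf
  exact ⟨(lequivProdOfRightSplitExact (j := (LinearMap.ker f).subtype) (g := f) (f := s)
    (Submodule.injective_subtype _) (by simp) hs).symm⟩

variable [IsNoetherianRing A]

/-- Schanuel's lemma in `K₀`: the class of a syzygy of `M` does not depend on the surjection from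
a finitely generated projective module onto `M`. -/
theorem K0.cls_ker_eq {M P Q : Type u} [AddCommGroup M] [Module A M] [AddCommGroup P]
    [Module A P] [AddCommGroup Q] [Module A Q] [Module.Finite A P] [Module.Finite A Q]
    [Module.Projective A P] [Module.Projective A Q] (f : P →ₗ[A] M) (g : Q →ₗ[A] M)
    (hf : Function.Surjective f) (hg : Function.Surjective g) :
    K0.cls (FGModuleCat.of A (LinearMap.ker f)) = K0.cls (FGModuleCat.of A (LinearMap.ker g)) := by
  let d : P × Q →ₗ[A] M := f.coprod (-g)
  let X := LinearMap.ker d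
  have hX : ∀ x : X, f x.1.1 = g x.1.2 := fun x => by
    have h := x.2
    simp only [X, d, LinearMap.mem_ker, LinearMap.coprod_apply, LinearMap.neg_apply] at h
    exact add_neg_eq_zero.1 h
  have hX' : ∀ p q, f p = g q → (p, q) ∈ X := fun p q h => by
    simp [X, d, h]
  let pr₁ : X →ₗ[A] P := (LinearMap.fst A P Q).comp X.subtype
  let pr₂ : X →ₗ[A] Q := (LinearMap.snd A P Q).comp X.subtype
  have h₁ : Function.Surjective pr₁ := fun p => by
    obtain ⟨q, hq⟩ := hg (f p)
    exact ⟨⟨(p, q), hX' p q hq.symm⟩, rfl⟩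
  have h₂ : Function.Surjective pr₂ := fun q => by
    obtain ⟨p, hp⟩ := hf (g q)
    exact ⟨⟨(p, q), hX' p q hp⟩, rfl⟩
  obtain ⟨e₁⟩ := nonempty_equiv_ker_prod pr₁ h₁
  obtain ⟨e₂⟩ := nonempty_equiv_ker_prod pr₂ h₂
  -- the kernel of the first projection is the kernel of `g`, and symmetrically
  let k₁ : LinearMap.ker pr₁ ≃ₗ[A] LinearMap.ker g :=
    { toFun := fun x => ⟨x.1.1.2, by
        have h := hX x.1
        have h0 : x.1.1.1 = 0 := x.2
        rw [h0, map_zero] at h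
        exact h.symm⟩
      invFun := fun y => ⟨⟨(0, y.1), hX' _ _ (by rw [map_zero]; exact y.2.symm)⟩, rfl⟩
      map_add' := fun _ _ => rfl
      map_smul' := fun _ _ => rfl
      left_inv := fun x => Subtype.ext (Subtype.ext (Prod.ext (Eq.symm x.2) rfl))
      right_inv := fun _ => rfl }
  let k₂ : LinearMap.ker pr₂ ≃ₗ[A] LinearMap.ker f :=
    { toFun := fun x => ⟨x.1.1.1, by
        have h := hX x.1
        have h0 : x.1.1.2 = 0 := x.2
        rw [h0, map_zero] at h
        exact h⟩
      invFun := fun y => ⟨⟨(y.1, 0), hX' _ _ (by rw [map_zero]; exact y.2)⟩, rfl⟩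
      map_add' := fun _ _ => rfl
      map_smul' := fun _ _ => rfl
      left_inv := fun x => Subtype.ext (Subtype.ext (Prod.ext rfl (Eq.symm x.2)))
      right_inv := fun _ => rfl }
  have c₁ := K0.cls_add (X := FGModuleCat.of A X) (Y := FGModuleCat.of A (LinearMap.ker g))
    (Z := FGModuleCat.of A P) (e₁.trans (k₁.prodCongr (LinearEquiv.refl A P)))
  have c₂ := K0.cls_add (X := FGModuleCat.of A X) (Y := FGModuleCat.of A (LinearMap.ker f))
    (Z := FGModuleCat.of A Q) (e₂.trans (k₂.prodCongr (LinearEquiv.refl A Q)))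
  rw [K0.cls_proj (FGModuleCat.of A P) ‹_›, add_zero] at c₁
  rw [K0.cls_proj (FGModuleCat.of A Q) ‹_›, add_zero] at c₂
  rw [← c₁, ← c₂]

/-- The kernel of a chosen surjection `Aⁿ → M`. In `K₀` it has the same class as the kernel of a
projective cover, by `K0.cls_ker_eq`. -/
noncomputable def syzygy (M : FGModuleCat.{u} A) : FGModuleCat.{u} A :=
  FGModuleCat.of A (LinearMap.ker (Module.Finite.exists_fin' A M).choose_spec.choose)

theorem K0.cls_syzygy {M : FGModuleCat.{u} A} {P : Type u} [AddCommGroup P] [Module A P]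
    [Module.Finite A P] [Module.Projective A P] (f : P →ₗ[A] M) (hf : Function.Surjective f) :
    K0.cls (syzygy M) = K0.cls (FGModuleCat.of A (LinearMap.ker f)) :=
  K0.cls_ker_eq _ _ (Module.Finite.exists_fin' A M).choose_spec.choose_spec hf

theorem K0.cls_syzygy_add {X Y Z : FGModuleCat.{u} A} (e : X ≃ₗ[A] Y × Z) :
    K0.cls (syzygy X) = K0.cls (syzygy Y) + K0.cls (syzygy Z) := by
  obtain ⟨m, f, hf⟩ := Module.Finite.exists_fin' A Y
  obtain ⟨n, g, hg⟩ := Module.Finite.exists_fin' A Z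
  have hs : Function.Surjective (e.symm.toLinearMap.comp (f.prodMap g)) :=
    e.symm.surjective.comp (hf.prodMap hg)
  rw [K0.cls_syzygy _ hs, K0.cls_syzygy f hf, K0.cls_syzygy g hg]
  have hk : ∀ x, x ∈ LinearMap.ker (e.symm.toLinearMap.comp (f.prodMap g)) ↔
      f x.1 = 0 ∧ g x.2 = 0 := fun x => by
    simp [LinearMap.mem_ker]
  exact K0.cls_add
    { toFun := fun x => (⟨x.1.1, ((hk _).1 x.2).1⟩, ⟨x.1.2, ((hk _).1 x.2).2⟩)
      invFun := fun y => ⟨(y.1.1, y.2.1), (hk _).2 ⟨y.1.2, y.2.2⟩⟩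
      map_add' := fun _ _ => rfl
      map_smul' := fun _ _ => rfl
      left_inv := fun _ => rfl
      right_inv := fun _ => rfl }

theorem K0.cls_syzygy_proj (P : FGModuleCat.{u} A) (hP : Module.Projective A P) :
    K0.cls (syzygy P) = 0 := by
  rw [K0.cls_syzygy (LinearMap.id : P →ₗ[A] P) Function.surjective_id]
  refine K0.cls_proj _ ?_
  have : Subsingleton (LinearMap.ker (LinearMap.id : P →ₗ[A] P)) := by
    rw [LinearMap.ker_id]; infer_instance
  change Module.Projective A (LinearMap.ker (LinearMap.id : P →ₗ[A] P))
  infer_instance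

variable (A) in
/-- The homomorphism `L : K₀ → K₀`, `L [M] = [Ω M]`. -/
noncomputable def syzygyMap : K0 A →ₗ[ℤ] K0 A :=
  (QuotientAddGroup.lift _ (FreeAbelianGroup.lift fun M => K0.cls (syzygy M)) (by
    rw [AddSubgroup.closure_le]
    rintro _ (⟨X, Y, Z, e⟩ | ⟨P, hP⟩)
    · simp [K0.cls_syzygy_add e]
    · simp [K0.cls_syzygy_proj P hP])).toIntLinearMap

theorem syzygyMap_cls (M : FGModuleCat.{u} A) :
    syzygyMap A (K0.cls M) = K0.cls (syzygy M) := by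
  simp [syzygyMap, K0.cls]

/-- The rank of the subgroup `L ^ t ⟨add M⟩`. -/
noncomputable def syzygyRank (M : FGModuleCat.{u} A) (t : ℕ) : ℕ :=
  Module.finrank ℤ ((addSpan M).map (syzygyMap A ^ t))

/-- The Igusa–Todorov function
`φ(M) = min {t | rank (L ^ t ⟨add M⟩) = rank (L ^ (t + j) ⟨add M⟩) for all j ≥ 1}`. -/
noncomputable def phi (M : FGModuleCat.{u} A) : ℕ :=
  sInf {t | ∀ j ≥ 1, syzygyRank M t = syzygyRank M (t + j)}

variable (A) in
/-- The `φ`-dimension: the supremum of `φ(M)` over the finitely generated modules `M`. -/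
noncomputable def phiDim : ℕ∞ := ⨆ M : FGModuleCat.{u} A, (phi M : ℕ∞)

end K0

section Gorenstein

variable (A : Type u) [Ring A]

/-- Every finitely generated injective module has finite projective dimension. -/
def IsGorenstein : Prop :=
  ∀ I : FGModuleCat.{u} A, Module.Injective A I →
    CategoryTheory.projectiveDimension I.obj ≠ ⊤

/-- The Gorenstein dimension: the supremum of the projective dimensions of the finitely generated
injective modules. The bottom element of `WithBot ℕ∞` is the projective dimension of the zero
module. -/
noncomputable def gorDim : WithBot ℕ∞ :=
  ⨆ (I : FGModuleCat.{u} A) (_ : Module.Injective A I), CategoryTheory.projectiveDimension I.obj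

end Gorenstein

end Homological

/-! ## Cyclic Nakayama algebras -/

namespace Nakayama

/-- A path in the cyclic quiver with vertices `ℤ/N` and one arrow `α i : i ⟶ i + 1` for each
vertex `i`. It is determined by its starting vertex and its length. -/
structure CyclicPath (N : ℕ) where
  /-- the starting vertex -/
  start : ZMod N
  /-- the number of arrows -/
  length : ℕ

/-- The vertex at which a path ends. -/
def CyclicPath.target {N : ℕ} (p : CyclicPath N) : ZMod N := p.start + p.length

/-- The path algebra `kQ` of the cyclic quiver `Q` on `N` vertices: the vector space with basis
the paths of `Q`. -/
def PathAlgebra (k : Type u) [Field k] (N : ℕ) : Type u := CyclicPath N →₀ k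

namespace PathAlgebra

variable {k : Type u} [Field k] {N : ℕ}

noncomputable instance : AddCommGroup (PathAlgebra k N) :=
  inferInstanceAs (AddCommGroup (CyclicPath N →₀ k))

noncomputable instance : Module k (PathAlgebra k N) :=
  inferInstanceAs (Module k (CyclicPath N →₀ k))

variable (k N) in
/-- The paths form a basis of `kQ`. -/
noncomputable def pathBasis : Module.Basis (CyclicPath N) k (PathAlgebra k N) :=
  Module.Basis.ofRepr (LinearEquiv.refl k (CyclicPath N →₀ k))

variable (k) in
/-- A path, as an element of `kQ`. -/
noncomputable def ofPath (p : CyclicPath N) : PathAlgebra k N := pathBasis k N p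

variable (k) in
/-- The product `q p` of two paths: `p` followed by `q` if `p` ends where `q` starts, and `0`
otherwise. -/
noncomputable def pathMul (q p : CyclicPath N) : PathAlgebra k N :=
  if p.target = q.start then ofPath k ⟨p.start, p.length + q.length⟩ else 0

variable (k N) in
/-- The bilinear extension of `pathMul`. -/
noncomputable def mulHom : PathAlgebra k N →ₗ[k] PathAlgebra k N →ₗ[k] PathAlgebra k N :=
  (pathBasis k N).constr k fun q => (pathBasis k N).constr k fun p => pathMul k q p

noncomputable instance : Mul (PathAlgebra k N) := ⟨fun f g => mulHom k N f g⟩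

/-- The identity is the sum of the trivial paths. -/
noncomputable instance [NeZero N] : One (PathAlgebra k N) := ⟨∑ i : ZMod N, ofPath k ⟨i, 0⟩⟩

theorem mul_def (f g : PathAlgebra k N) : f * g = mulHom k N f g := rfl

theorem one_def [NeZero N] : (1 : PathAlgebra k N) = ∑ i : ZMod N, ofPath k ⟨i, 0⟩ := rfl

theorem ofPath_mul_ofPath (q p : CyclicPath N) : ofPath k q * ofPath k p = pathMul k q p := by
  rw [mul_def, mulHom, ofPath, ofPath, Module.Basis.constr_basis, Module.Basis.constr_basis]

theorem induction {motive : PathAlgebra k N → Prop} (f : PathAlgebra k N)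
    (path : ∀ p : CyclicPath N, motive (ofPath k p)) (zero : motive 0)
    (add : ∀ f g, motive f → motive g → motive (f + g))
    (smul : ∀ (c : k) f, motive f → motive (c • f)) : motive f := by
  have h : f ∈ Submodule.span k (Set.range (pathBasis k N)) := by
    rw [(pathBasis k N).span_eq]; trivial
  induction h using Submodule.span_induction with
  | mem x hx => obtain ⟨p, rfl⟩ := hx; exact path p
  | zero => exact zero
  | add x y _ _ hx hy => exact add x y hx hy
  | smul c x _ hx => exact smul c x hx

protected theorem left_distrib (f g h : PathAlgebra k N) : f * (g + h) = f * g + f * h := by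
  simp only [mul_def, map_add]

protected theorem right_distrib (f g h : PathAlgebra k N) : (f + g) * h = f * h + g * h := by
  simp only [mul_def, map_add, LinearMap.add_apply]

protected theorem zero_mul (f : PathAlgebra k N) : 0 * f = 0 := by
  simp only [mul_def, map_zero, LinearMap.zero_apply]

protected theorem mul_zero (f : PathAlgebra k N) : f * 0 = 0 := by
  simp only [mul_def, map_zero]

protected theorem smul_mul (c : k) (f g : PathAlgebra k N) : (c • f) * g = c • (f * g) := by
  simp only [mul_def, map_smul, LinearMap.smul_apply]

protected theorem mul_smul (c : k) (f g : PathAlgebra k N) : f * (c • g) = c • (f * g) := by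
  simp only [mul_def, map_smul]

protected theorem mul_assoc (f g h : PathAlgebra k N) : f * g * h = f * (g * h) := by
  induction f using PathAlgebra.induction with
  | zero => simp only [PathAlgebra.zero_mul]
  | add a b ha hb => simp only [PathAlgebra.right_distrib, ha, hb]
  | smul c a ha => simp only [PathAlgebra.smul_mul, ha]
  | path r =>
  induction g using PathAlgebra.induction with
  | zero => simp only [PathAlgebra.zero_mul, PathAlgebra.mul_zero]
  | add a b ha hb => simp only [PathAlgebra.right_distrib, PathAlgebra.left_distrib, ha, hb]
  | smul c a ha => simp only [PathAlgebra.smul_mul, PathAlgebra.mul_smul, ha]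
  | path q =>
  induction h using PathAlgebra.induction with
  | zero => simp only [PathAlgebra.mul_zero]
  | add a b ha hb => simp only [PathAlgebra.left_distrib, ha, hb]
  | smul c a ha => simp only [PathAlgebra.mul_smul, ha]
  | path p =>
  simp only [ofPath_mul_ofPath, pathMul]
  by_cases h₁ : q.target = r.start <;> by_cases h₂ : p.target = q.start
  · have h₃ : (⟨p.start, p.length + q.length⟩ : CyclicPath N).target = r.start := by
      rw [← h₁, CyclicPath.target, CyclicPath.target, ← h₂, CyclicPath.target]
      push_cast; ring
    rw [if_pos h₁, if_pos h₂, ofPath_mul_ofPath, ofPath_mul_ofPath, pathMul, pathMul, if_pos h₂,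
      if_pos h₃, add_assoc]
  · rw [if_pos h₁, if_neg h₂, ofPath_mul_ofPath, pathMul, if_neg h₂, PathAlgebra.mul_zero]
  · have h₃ : (⟨p.start, p.length + q.length⟩ : CyclicPath N).target ≠ r.start := by
      intro h₃
      apply h₁
      rw [← h₃, CyclicPath.target, CyclicPath.target, ← h₂, CyclicPath.target]
      push_cast; ring
    rw [if_neg h₁, if_pos h₂, ofPath_mul_ofPath, pathMul, if_neg h₃, PathAlgebra.zero_mul]
  · rw [if_neg h₁, if_neg h₂, PathAlgebra.zero_mul, PathAlgebra.mul_zero]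

variable [NeZero N]

protected theorem one_mul (f : PathAlgebra k N) : 1 * f = f := by
  induction f using PathAlgebra.induction with
  | zero => exact PathAlgebra.mul_zero 1
  | add a b ha hb => rw [PathAlgebra.left_distrib, ha, hb]
  | smul c a ha => rw [PathAlgebra.mul_smul, ha]
  | path p =>
  rw [one_def, mul_def, map_sum, LinearMap.sum_apply, Finset.sum_eq_single p.target]
  · rw [← mul_def, ofPath_mul_ofPath, pathMul, if_pos rfl]; rfl
  · intro i _ hi
    rw [← mul_def, ofPath_mul_ofPath, pathMul, if_neg (Ne.symm hi)]
  · intro h; exact absurd (Finset.mem_univ _) h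

protected theorem mul_one (f : PathAlgebra k N) : f * 1 = f := by
  induction f using PathAlgebra.induction with
  | zero => exact PathAlgebra.zero_mul 1
  | add a b ha hb => rw [PathAlgebra.right_distrib, ha, hb]
  | smul c a ha => rw [PathAlgebra.smul_mul, ha]
  | path p =>
  have ht : ∀ i : ZMod N, (⟨i, 0⟩ : CyclicPath N).target = i := fun i => by
    simp [CyclicPath.target]
  rw [one_def, mul_def, map_sum, Finset.sum_eq_single p.start]
  · rw [← mul_def, ofPath_mul_ofPath, pathMul, if_pos (ht _), zero_add]
  · intro i _ hi
    rw [← mul_def, ofPath_mul_ofPath, pathMul, ht, if_neg hi]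
  · intro h; exact absurd (Finset.mem_univ _) h

noncomputable instance : Ring (PathAlgebra k N) :=
  { (inferInstance : AddCommGroup (PathAlgebra k N)) with
    left_distrib := PathAlgebra.left_distrib
    right_distrib := PathAlgebra.right_distrib
    zero_mul := PathAlgebra.zero_mul
    mul_zero := PathAlgebra.mul_zero
    mul_assoc := PathAlgebra.mul_assoc
    one_mul := PathAlgebra.one_mul
    mul_one := PathAlgebra.mul_one }

noncomputable instance : Algebra k (PathAlgebra k N) :=
  Algebra.ofModule PathAlgebra.smul_mul PathAlgebra.mul_smul

end PathAlgebra

/-- A system of relations: a nonempty set of paths of the cyclic quiver, all of length at least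
`2`. -/
structure Relations (N : ℕ) where
  /-- the paths that are set to zero -/
  paths : Set (CyclicPath N)
  nonempty : paths.Nonempty
  two_le_length : ∀ p ∈ paths, 2 ≤ p.length

variable (k : Type u) [Field k] {N : ℕ} [NeZero N] (R : Relations N)

/-- The cyclic Nakayama algebra `kQ / ⟨R⟩`: the quotient of the path algebra of the cyclic quiver
by the two-sided ideal generated by the paths in `R`. -/
abbrev NakayamaAlgebra : Type u :=
  RingQuot fun x y : PathAlgebra k N => (∃ p ∈ R.paths, x = PathAlgebra.ofPath k p) ∧ y = 0

namespace NakayamaAlgebra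

/-- The image of a path in `kQ / ⟨R⟩`. -/
noncomputable def path (p : CyclicPath N) : NakayamaAlgebra k R :=
  RingQuot.mkAlgHom k _ (PathAlgebra.ofPath k p)

theorem path_mul_path (q p : CyclicPath N) (h : p.target = q.start) :
    path k R q * path k R p = path k R ⟨p.start, p.length + q.length⟩ := by
  rw [path, path, ← map_mul, PathAlgebra.ofPath_mul_ofPath, PathAlgebra.pathMul, if_pos h, path]

theorem path_eq_zero {p : CyclicPath N} (hp : p ∈ R.paths) : path k R p = 0 := by
  rw [path, RingQuot.mkAlgHom_rel k ⟨⟨p, hp, rfl⟩, rfl⟩, map_zero]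

/-- Long paths contain a relation, so they vanish. -/
theorem exists_path_eq_zero : ∃ m : ℕ, ∀ p : CyclicPath N, m ≤ p.length → path k R p = 0 := by
  obtain ⟨r, hr⟩ := R.nonempty
  refine ⟨N + r.length, fun p hp => ?_⟩
  have ha : (r.start - p.start).val < N := ZMod.val_lt _
  obtain ⟨b, hb⟩ := Nat.exists_eq_add_of_le
    (show (r.start - p.start).val + r.length ≤ p.length by omega)
  have h₁ : (⟨p.start, (r.start - p.start).val⟩ : CyclicPath N).target = r.start := by
    simp [CyclicPath.target]
  have h₂ : path k R ⟨p.start, (r.start - p.start).val + r.length⟩ = 0 := by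
    rw [← path_mul_path k R r ⟨p.start, (r.start - p.start).val⟩ h₁, path_eq_zero k R hr, zero_mul]
  have h₃ := path_mul_path k R
    ⟨(⟨p.start, (r.start - p.start).val + r.length⟩ : CyclicPath N).target, b⟩
    ⟨p.start, (r.start - p.start).val + r.length⟩ rfl
  rw [h₂, mul_zero, ← hb] at h₃
  exact h₃.symm

instance : Module.Finite k (NakayamaAlgebra k R) := by
  obtain ⟨m, hm⟩ := exists_path_eq_zero k R
  let v : ZMod N × Fin m → NakayamaAlgebra k R := fun x => path k R ⟨x.1, x.2⟩
  suffices h : ∀ y, y ∈ Submodule.span k (Set.range v) from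
    ⟨Submodule.fg_def.2 ⟨_, Set.finite_range v, eq_top_iff.2 fun y _ => h y⟩⟩
  intro y
  obtain ⟨x, rfl⟩ := RingQuot.mkAlgHom_surjective k _ y
  induction x using PathAlgebra.induction with
  | zero => rw [map_zero]; exact zero_mem _
  | add a b ha hb => rw [map_add]; exact add_mem ha hb
  | smul c a ha => rw [map_smul]; exact Submodule.smul_mem _ c ha
  | path p =>
    by_cases hp : p.length < m
    · exact Submodule.subset_span ⟨(p.start, ⟨p.length, hp⟩), rfl⟩
    · have h := hm p (not_lt.1 hp)
      rw [path] at h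
      rw [h]
      exact zero_mem _

/-- A finite-dimensional algebra is left Noetherian. -/
instance : IsNoetherianRing (NakayamaAlgebra k R) :=
  isNoetherian_of_tower k (inferInstance : IsNoetherian k (NakayamaAlgebra k R))

end NakayamaAlgebra

end Nakayama

/-!
For a Gorenstein algebra both sides are read off from the behaviour of the syzygy operator.

*Lower bound.* Let `M` be indecomposable of finite projective dimension `n`. Then `⟨add M⟩` is
generated by `[M]`, and `L ^ t [M]` is the class of the `t`-th syzygy, which is projective exactly
for `n ≤ t`. A nonprojective module `X` has a class of infinite order, because the dimension of
`Hom(-, X)` modulo the maps that factor through projective modules is an additive function on `K₀`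
which does not vanish at `X` (`exists_functional_cls_ne_zero`). Hence `φ(M) = n`. Since every module
of finite projective dimension has an indecomposable summand of the same projective dimension, the
projective dimension of every injective module is at most `φdim`
(`projectiveDimension_le_phiDim`).

*Upper bound.* Sending a module to the cokernel of a left approximation by a projective module
defines an endomorphism of `K₀` (`exists_cosyzygyMap`), which maps `L [X]` back to `[X]` as soon as
`Ext¹(X, A) = 0`. So if `Ext ^ (d + 1) (M, A) = 0` for all `M`, then `L` is injective on the image
of `L ^ d`, and the ranks of `L ^ t ⟨add M⟩` are constant from `t = d` on
(`phi_le_of_isLeftApproximation`). Let `d` bound the projective dimensions of the injective modules.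
If the injective dimension of `A` is finite, it is at most `d`, because every module embeds into an
injective one (`subsingleton_ext_of_embeddings`).

*Finiteness of the injective dimension of `A`.* The Gorenstein condition speaks of the projective
dimensions of injective modules only, so this needs an argument. The indecomposable projective
modules are uniserial, and every uniserial module embeds into an injective uniserial module with
uniserial cokernel (`Uniserial.exists_cosyzygy`). So the iterated cosyzygies of an indecomposable
projective module are uniserial and of finite projective dimension. As there are only finitely many
uniserial modules, their projective dimensions are at most some `D`, and then the extension of the
`(D + 1)`-st cosyzygy by the `D`-th one splits (`hasInjectiveDimensionLT_of_cosyzygies`).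
-/

open CategoryTheory Abelian

/-! ### Additive functions on `K₀` that detect nonprojective modules -/

namespace Homological

section DetectProjective

variable {k A : Type u} [Field k] [Ring A] [Algebra k A]

theorem finite_linearMap_of_finite (Z W : Type u) [AddCommGroup Z] [Module A Z] [Module.Finite A Z]
    [AddCommGroup W] [Module A W] [Module k W] [IsScalarTower k A W] [Module.Finite k W] :
    Module.Finite k (Z →ₗ[A] W) := by
  obtain ⟨n, f, hf⟩ := Module.Finite.exists_fin' A Z
  let Φ : (Z →ₗ[A] W) →ₗ[k] (Fin n → W) :=
    { toFun := fun φ i => φ (f (Pi.single i 1))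
      map_add' := fun _ _ => rfl
      map_smul' := fun _ _ => rfl }
  refine Module.Finite.of_injective Φ fun φ ψ h => ?_
  have : φ ∘ₗ f = ψ ∘ₗ f := by
    refine LinearMap.pi_ext' fun i => LinearMap.ext_ring ?_
    simpa [Φ] using congrFun h i
  exact LinearMap.ext fun z => by
    obtain ⟨x, rfl⟩ := hf z
    exact LinearMap.congr_fun this x

/-- Every nonprojective module is detected by an additive function on `K₀`. For a free cover
`0 → K → F → X → 0` the function is
`[Z] ↦ dim Hom(Z, K) - dim Hom(Z, F) + dim Hom(Z, X)`, the dimension of the space of maps `Z → X`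
modulo those that factor through a projective module. -/
theorem exists_functional_cls_ne_zero [Module.Finite k A] (X : FGModuleCat.{u} A)
    (hX : ¬ Module.Projective A X) : ∃ χ : K0 A →ₗ[ℤ] ℤ, χ (K0.cls X) ≠ 0 := by
  obtain ⟨n, f, hf⟩ := Module.Finite.exists_fin' A X
  let : Module k X := Module.compHom X (algebraMap k A)
  have : IsScalarTower k A X := ⟨fun c a x => by
    rw [Algebra.smul_def, mul_smul]; rfl⟩
  have : Module.Finite k X := Module.Finite.trans A X
  -- the pushforward along `f` and its rank on `Hom(Z, F)`
  let push (Z : FGModuleCat.{u} A) : (Z →ₗ[A] (Fin n → A)) →ₗ[k] (Z →ₗ[A] X) :=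
    { toFun := fun φ => f ∘ₗ φ
      map_add' := fun _ _ => LinearMap.comp_add _ _ _
      map_smul' := fun c φ => LinearMap.ext fun z => by
        simp only [LinearMap.comp_apply, LinearMap.smul_apply, RingHom.id_apply]
        exact (f.restrictScalars k).map_smul c _ }
  have hker (Z : FGModuleCat.{u} A) : Module.finrank k (LinearMap.ker (push Z)) =
      Module.finrank k (Z →ₗ[A] LinearMap.ker f) :=
    LinearEquiv.finrank_eq
      { toFun := fun φ => φ.1.codRestrict _ fun z => LinearMap.congr_fun (f := f ∘ₗ φ.1) φ.2 z
        invFun := fun ψ => ⟨(LinearMap.ker f).subtype ∘ₗ ψ, LinearMap.ext fun z => (ψ z).2⟩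
        map_add' := fun _ _ => rfl
        map_smul' := fun _ _ => rfl
        left_inv := fun _ => rfl
        right_inv := fun _ => rfl }
  have : Module.Finite k (LinearMap.ker f) :=
    Module.Finite.of_injective ((LinearMap.ker f).subtype.restrictScalars k)
      (Submodule.injective_subtype _)
  have hfin (Z : FGModuleCat.{u} A) : Module.Finite k (Z →ₗ[A] X) :=
    finite_linearMap_of_finite _ _
  have hfin' (Z : FGModuleCat.{u} A) : Module.Finite k (Z →ₗ[A] (Fin n → A)) :=
    finite_linearMap_of_finite _ _
  have hfin'' (Z : FGModuleCat.{u} A) : Module.Finite k (Z →ₗ[A] (LinearMap.ker f)) :=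
    finite_linearMap_of_finite _ _
  let v (Z : FGModuleCat.{u} A) : ℤ := Module.finrank k (Z →ₗ[A] LinearMap.ker f)
    - Module.finrank k (Z →ₗ[A] (Fin n → A)) + Module.finrank k (Z →ₗ[A] X)
  have hv (Z : FGModuleCat.{u} A) : v Z = 0 ↔ Function.Surjective (push Z) := by
    have h := LinearMap.finrank_range_add_finrank_ker (push Z)
    rw [hker] at h
    rw [← LinearMap.range_eq_top]
    constructor
    · intro h0
      apply Submodule.eq_top_of_finrank_eq
      simp only [v] at h0
      omega
    · intro h0
      rw [h0, finrank_top] at h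
      simp only [v]
      omega
  have hadd (W : Type u) [AddCommGroup W] [Module A W] [Module k W] [IsScalarTower k A W]
      [Module.Finite k W] (X Y Z : FGModuleCat.{u} A) (e : X ≃ₗ[A] Y × Z) :
      Module.finrank k (X →ₗ[A] W) =
        Module.finrank k (Y →ₗ[A] W) + Module.finrank k (Z →ₗ[A] W) := by
    have : Module.Finite k (Y →ₗ[A] W) := finite_linearMap_of_finite _ _
    have : Module.Finite k (Z →ₗ[A] W) := finite_linearMap_of_finite _ _
    rw [← Module.finrank_prod]
    exact LinearEquiv.finrank_eq
      { toFun := fun φ => (φ ∘ₗ e.symm.toLinearMap ∘ₗ LinearMap.inl A Y Z,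
          φ ∘ₗ e.symm.toLinearMap ∘ₗ LinearMap.inr A Y Z)
        invFun := fun ψ => (ψ.1.coprod ψ.2) ∘ₗ e.toLinearMap
        map_add' := fun _ _ => rfl
        map_smul' := fun _ _ => rfl
        left_inv := fun φ => LinearMap.ext fun x => by
          simp only [LinearMap.comp_apply, LinearMap.coprod_apply, LinearMap.inl_apply,
            LinearMap.inr_apply, LinearEquiv.coe_coe]
          rw [← map_add, ← map_add]
          simp
        right_inv := fun ψ => by
          ext <;> simp }
  refine ⟨(QuotientAddGroup.lift _ (FreeAbelianGroup.lift v) ?_).toIntLinearMap, ?_⟩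
  · rw [AddSubgroup.closure_le]
    rintro _ (⟨X', Y, Z, e⟩ | ⟨P, hP⟩)
    · have h₁ := hadd (LinearMap.ker f) X' Y Z e
      have h₂ := hadd (Fin n → A) X' Y Z e
      have h₃ := hadd X X' Y Z e
      simp only [SetLike.mem_coe, AddMonoidHom.mem_ker, map_sub, map_add,
        FreeAbelianGroup.lift_apply_of, v]
      omega
    · simp only [SetLike.mem_coe, AddMonoidHom.mem_ker, FreeAbelianGroup.lift_apply_of]
      rw [hv]
      intro φ
      obtain ⟨ψ, hψ⟩ := Module.projective_lifting_property f φ hf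
      exact ⟨ψ, hψ⟩
  · have : v X ≠ 0 := fun h => by
      obtain ⟨s, hs⟩ := (hv X).1 h LinearMap.id
      exact hX (Module.Projective.of_split s f hs)
    simpa [K0.cls] using this

end DetectProjective
end Homological

/-! ### Projective dimension and the lower bound for the `φ`-dimension -/

namespace Homological

section ProjectiveDimension

variable {A : Type u} [Ring A]

theorem shortExact_moduleCatMk {X Y Z : Type u} [AddCommGroup X] [Module A X] [AddCommGroup Y]
    [Module A Y] [AddCommGroup Z] [Module A Z] (f : X →ₗ[A] Y) (g : Y →ₗ[A] Z)
    (hf : Function.Injective f) (hg : Function.Surjective g) (h : Function.Exact f g) :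
    (ShortComplex.moduleCatMk f g h.linearMap_comp_eq_zero).ShortExact where
  exact := by
    rw [ShortComplex.moduleCat_exact_iff_range_eq_ker]
    exact (LinearMap.exact_iff.1 h).symm
  mono_f := (ModuleCat.mono_iff_injective _).2 hf
  epi_g := (ModuleCat.epi_iff_surjective _).2 hg

theorem hasProjectiveDimensionLT_one_iff (P : ModuleCat.{u} A) :
    HasProjectiveDimensionLT P 1 ↔ Module.Projective A P := by
  rw [← projective_iff_hasProjectiveDimensionLT_one]
  exact (IsProjective.iff_projective P).symm

theorem hasProjectiveDimensionLT_of_linearEquiv {X Y : ModuleCat.{u} A} (e : X ≃ₗ[A] Y) (n : ℕ)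
    (h : HasProjectiveDimensionLT X n) : HasProjectiveDimensionLT Y n :=
  hasProjectiveDimensionLT_of_iso e.toModuleIso n

theorem hasProjectiveDimensionLT_prod_iff {X Y : Type u} [AddCommGroup X] [Module A X]
    [AddCommGroup Y] [Module A Y] (n : ℕ) :
    HasProjectiveDimensionLT (ModuleCat.of A (X × Y)) n ↔
      HasProjectiveDimensionLT (ModuleCat.of A X) n ∧
        HasProjectiveDimensionLT (ModuleCat.of A Y) n := by
  refine ⟨fun h => ⟨?_, ?_⟩, fun h => ?_⟩
  · exact Retract.hasProjectiveDimensionLT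
      ⟨ModuleCat.ofHom (LinearMap.inl A X Y), ModuleCat.ofHom (LinearMap.fst A X Y), rfl⟩ n
  · exact Retract.hasProjectiveDimensionLT
      ⟨ModuleCat.ofHom (LinearMap.inr A X Y), ModuleCat.ofHom (LinearMap.snd A X Y), rfl⟩ n
  · exact (shortExact_moduleCatMk (LinearMap.inl A X Y) (LinearMap.snd A X Y)
      LinearMap.inl_injective LinearMap.snd_surjective
      Function.Exact.inl_snd).hasProjectiveDimensionLT_X₂ n h.1 h.2

theorem addSpan_of_isIndecomposable {M : FGModuleCat.{u} A} (hM : IsIndecomposable M) :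
    addSpan M = Submodule.span ℤ {K0.cls M} := by
  apply le_antisymm
  · rw [addSpan, Submodule.span_le]
    rintro _ ⟨X, Y, hX, ⟨e⟩, rfl⟩
    have hXY : IsCompl (Submodule.prod (⊤ : Submodule A X) (⊥ : Submodule A Y))
        (Submodule.prod (⊥ : Submodule A X) (⊤ : Submodule A Y)) := by
      constructor
      · rw [disjoint_iff, Submodule.prod_inf_prod]; simp
      · rw [codisjoint_iff, Submodule.prod_sup_prod]; simp
    have hc := hXY.map (Submodule.orderIsoMapComap e.symm)
    rcases hM.2 _ _ hc with h | h
    · replace h := (map_eq_bot_iff (Submodule.orderIsoMapComap e.symm)).1 h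
      obtain ⟨x, hx⟩ := @exists_ne X hX.1 0
      have : ((x, 0) : X × Y) ∈ (⊥ : Submodule A (X × Y)) := h ▸ ⟨trivial, rfl⟩
      exact absurd (congrArg Prod.fst ((Submodule.mem_bot A).1 this)) hx
    · replace h := (map_eq_bot_iff (Submodule.orderIsoMapComap e.symm)).1 h
      have hY : Subsingleton Y := subsingleton_of_forall_eq 0 fun y => by
        have : ((0, y) : X × Y) ∈ (⊥ : Submodule A (X × Y)) := h ▸ ⟨rfl, trivial⟩
        exact congrArg Prod.snd ((Submodule.mem_bot A).1 this)
      have h := K0.cls_add e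
      rw [K0.cls_proj Y inferInstance, add_zero] at h
      rw [← h]
      exact Submodule.mem_span_singleton_self _
  · rw [addSpan, Submodule.span_singleton_le_iff_mem]
    exact Submodule.subset_span ⟨M, FGModuleCat.of A PUnit, hM,
      ⟨(LinearEquiv.prodUnique (R := A) (M := M) (M₂ := PUnit.{u + 1})).symm⟩, rfl⟩

end ProjectiveDimension

section LowerBound

variable {A : Type u} [Ring A] [IsNoetherianRing A]

theorem hasProjectiveDimensionLT_syzygy_iff (M : FGModuleCat.{u} A) (n : ℕ) :
    HasProjectiveDimensionLT (syzygy M).obj (n + 1) ↔ HasProjectiveDimensionLT M.obj (n + 2) := by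
  have hS := LinearMap.shortExact_shortComplexKer
    (Module.Finite.exists_fin' A M).choose_spec.choose_spec
  exact (hS.hasProjectiveDimensionLT_X₃_iff n
    ((IsProjective.iff_projective _).1 (inferInstanceAs (Module.Projective A (Fin _ → A))))).symm

theorem projective_iterate_syzygy_iff (M : FGModuleCat.{u} A) (n : ℕ) :
    Module.Projective A (syzygy^[n] M) ↔ HasProjectiveDimensionLT M.obj (n + 1) := by
  rw [← hasProjectiveDimensionLT_one_iff]
  induction n generalizing M with
  | zero => rfl
  | succ n ih =>
    rw [Function.iterate_succ_apply, ← hasProjectiveDimensionLT_syzygy_iff]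
    exact ih _

theorem syzygyMap_pow_cls (M : FGModuleCat.{u} A) (n : ℕ) :
    (syzygyMap A ^ n) (K0.cls M) = K0.cls (syzygy^[n] M) := by
  induction n generalizing M with
  | zero => rfl
  | succ n ih =>
    rw [Function.iterate_succ_apply, ← ih, pow_succ, Module.End.mul_apply, syzygyMap_cls]

theorem finrank_span_singleton_ne_zero {G : Type*} [AddCommGroup G] (x : G) (χ : G →ₗ[ℤ] ℤ)
    (hχ : χ x ≠ 0) : Module.finrank ℤ (Submodule.span ℤ {x}) ≠ 0 := by
  let v : Unit → Submodule.span ℤ {x} := fun _ => ⟨x, Submodule.mem_span_singleton_self x⟩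
  have hv : LinearIndependent ℤ v := by
    refine LinearIndependent.of_comp (χ ∘ₗ (Submodule.span ℤ {x}).subtype) ?_
    exact LinearIndependent.of_subsingleton () hχ
  have := hv.fintype_card_le_finrank
  simp at this
  omega

theorem le_phi_of_isIndecomposable {k : Type u} [Field k] [Algebra k A] [Module.Finite k A]
    {M : FGModuleCat.{u} A} (hM : IsIndecomposable M) {n : ℕ}
    (h : HasProjectiveDimensionLT M.obj (n + 1)) (h' : ¬ HasProjectiveDimensionLT M.obj n) :
    n ≤ phi M := by
  have hr (t : ℕ) : syzygyRank M t =
      Module.finrank ℤ (Submodule.span ℤ {K0.cls (syzygy^[t] M)}) := by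
    rw [syzygyRank, addSpan_of_isIndecomposable hM, Submodule.map_span, Set.image_singleton,
      syzygyMap_pow_cls]
  have hpos (t : ℕ) (ht : t < n) : syzygyRank M t ≠ 0 := by
    obtain ⟨χ, hχ⟩ := exists_functional_cls_ne_zero (k := k) (syzygy^[t] M) (by
      rw [projective_iterate_syzygy_iff]
      intro h₀
      exact h' (hasProjectiveDimensionLT_of_ge _ (t + 1) n ht))
    rw [hr]
    exact finrank_span_singleton_ne_zero _ χ hχ
  have hzero (t : ℕ) (ht : n ≤ t) : syzygyRank M t = 0 := by
    have : K0.cls (syzygy^[t] M) = 0 := K0.cls_proj _ <| by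
      rw [projective_iterate_syzygy_iff]
      exact hasProjectiveDimensionLT_of_ge _ (n + 1) (t + 1) (by omega)
    rw [hr, this, Submodule.span_zero_singleton, finrank_bot]
  refine le_csInf ⟨n, fun j _ => by rw [hzero n le_rfl, hzero _ (by omega)]⟩ fun t ht => ?_
  by_contra! hlt
  apply hpos t hlt
  rw [ht (n - t) (by omega), hzero _ (by omega)]

/-- A module of finite projective dimension has an indecomposable summand of the same projective
dimension, on which `φ` takes a value at least as large. -/
theorem projectiveDimension_le_phiDim {k : Type u} [Field k] [Algebra k A] [Module.Finite k A]
    (M : FGModuleCat.{u} A) (hM : projectiveDimension M.obj ≠ ⊤) :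
    projectiveDimension M.obj ≤ (phiDim A : WithBot ℕ∞) := by
  have : IsArtinianRing A := IsArtinianRing.of_finite k A
  -- the submodules of `M` satisfy the descending chain condition
  suffices h : ∀ (U : Submodule A M) (n : ℕ), HasProjectiveDimensionLT (ModuleCat.of A U) (n + 1) →
      ¬ HasProjectiveDimensionLT (ModuleCat.of A U) n → (n : ℕ∞) ≤ phiDim A by
    generalize hd : projectiveDimension M.obj = d at hM ⊢
    induction d with
    | bot => exact bot_le
    | coe d =>
      induction d with
      | top => exact absurd rfl hM
      | coe d =>
        refine WithBot.coe_le_coe.2 (h ⊤ d ?_ ?_)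
        · exact hasProjectiveDimensionLT_of_linearEquiv (X := M.obj)
            (Submodule.topEquiv (R := A) (M := M)).symm _
            ((projectiveDimension_le_iff _ _).1 hd.le)
        · exact fun h => (projectiveDimension_ge_iff M.obj d).1 hd.ge
            (hasProjectiveDimensionLT_of_linearEquiv (Y := M.obj)
              (Submodule.topEquiv (R := A) (M := M)) _ h)
  intro U
  induction U using WellFoundedLT.induction with
  | ind U ih =>
  intro n h h'
  by_cases hU : IsIndecomposable (FGModuleCat.of A U)
  · exact le_trans (Nat.cast_le.2 (le_phi_of_isIndecomposable (k := k) hU h h'))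
      (le_iSup (fun M : FGModuleCat.{u} A => (phi M : ℕ∞)) _)
  rcases subsingleton_or_nontrivial U with hs | hs
  · have h₀ := (ModuleCat.isZero_of_subsingleton (ModuleCat.of A U)).hasProjectiveDimensionLT_zero
    exact absurd (hasProjectiveDimensionLT_of_ge _ 0 n (Nat.zero_le n)) h'
  obtain ⟨V, W, hVW, hV, hW⟩ : ∃ V W : Submodule A U, IsCompl V W ∧ V ≠ ⊥ ∧ W ≠ ⊥ := by
    by_contra! hc
    exact hU ⟨hs, fun V W hVW => or_iff_not_imp_left.2 fun hV => hc V W hVW hV⟩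
  have hlt (V W : Submodule A U) (hVW : IsCompl V W) (hW : W ≠ ⊥) : V.map U.subtype < U := by
    refine lt_of_le_of_ne (Submodule.map_subtype_le _ _) fun he => hW ?_
    have : V = ⊤ := by
      apply Submodule.map_injective_of_injective U.injective_subtype
      rw [he, Submodule.map_subtype_top]
    exact eq_bot_of_top_isCompl (this ▸ hVW)
  have key (V : Submodule A U) (m : ℕ) :
      HasProjectiveDimensionLT (ModuleCat.of A V) m ↔
        HasProjectiveDimensionLT (ModuleCat.of A (V.map U.subtype)) m := by
    have e := V.equivMapOfInjective U.subtype U.injective_subtype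
    exact ⟨hasProjectiveDimensionLT_of_linearEquiv (X := ModuleCat.of A V)
      (Y := ModuleCat.of A (V.map U.subtype)) e _,
      hasProjectiveDimensionLT_of_linearEquiv (Y := ModuleCat.of A V)
      (X := ModuleCat.of A (V.map U.subtype)) e.symm _⟩
  have hprod (m : ℕ) : HasProjectiveDimensionLT (ModuleCat.of A U) m ↔
      HasProjectiveDimensionLT (ModuleCat.of A V) m ∧
        HasProjectiveDimensionLT (ModuleCat.of A W) m := by
    rw [← hasProjectiveDimensionLT_prod_iff]
    have e := Submodule.prodEquivOfIsCompl V W hVW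
    exact ⟨hasProjectiveDimensionLT_of_linearEquiv (X := ModuleCat.of A U)
      (Y := ModuleCat.of A (V × W)) e.symm _,
      hasProjectiveDimensionLT_of_linearEquiv (Y := ModuleCat.of A U)
      (X := ModuleCat.of A (V × W)) e _⟩
  rw [hprod] at h h'
  by_cases hV' : HasProjectiveDimensionLT (ModuleCat.of A V) n
  · exact ih _ (hlt W V hVW.symm hV) n ((key _ _).1 h.2) fun h₀ => h' ⟨hV', (key _ _).2 h₀⟩
  · exact ih _ (hlt V W hVW hW) n ((key _ _).1 h.1) fun h₀ => hV' ((key _ _).2 h₀)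

end LowerBound
end Homological

/-! ### Left approximations and the upper bound for `φ` -/

namespace Homological

section Approximation

variable {A : Type u} [Ring A]

/-- A homomorphism `u : Z → F` is a left `A`-approximation if every homomorphism from `Z` to the
regular module factors through `u`. It need not be injective. -/
def IsLeftApproximation {Z F : Type u} [AddCommGroup Z] [Module A Z] [AddCommGroup F] [Module A F]
    (u : Z →ₗ[A] F) : Prop :=
  ∀ g : Z →ₗ[A] A, ∃ h : F →ₗ[A] A, h ∘ₗ u = g

variable {Z F : Type u} [AddCommGroup Z] [Module A Z] [AddCommGroup F] [Module A F]

theorem IsLeftApproximation.exists_extend {u : Z →ₗ[A] F} (hu : IsLeftApproximation u)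
    {Q : Type u} [AddCommGroup Q] [Module A Q] [Module.Finite A Q] [Module.Projective A Q]
    (g : Z →ₗ[A] Q) : ∃ h : F →ₗ[A] Q, h ∘ₗ u = g := by
  obtain ⟨n, p, hp⟩ := Module.Finite.exists_fin' A Q
  obtain ⟨s, hs⟩ := Module.projective_lifting_property p LinearMap.id hp
  choose h hh using fun i => hu (LinearMap.proj i ∘ₗ s ∘ₗ g)
  refine ⟨p ∘ₗ LinearMap.pi h, LinearMap.ext fun z => ?_⟩
  have : LinearMap.pi h (u z) = s (g z) := funext fun i => LinearMap.congr_fun (hh i) z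
  rw [LinearMap.comp_apply, LinearMap.comp_apply, this]
  exact LinearMap.congr_fun hs (g z)

theorem exists_isLeftApproximation (k : Type u) [Field k] [Algebra k A] [Module.Finite k A]
    (Z : FGModuleCat.{u} A) : ∃ (n : ℕ) (u : Z →ₗ[A] (Fin n → A)), IsLeftApproximation u := by
  have : Module.Finite k (Z →ₗ[A] A) := finite_linearMap_of_finite _ _
  obtain ⟨n, b, hb⟩ := Module.Finite.exists_fin (R := k) (M := Z →ₗ[A] A)
  refine ⟨n, LinearMap.pi b, fun g => ?_⟩
  obtain ⟨c, hc⟩ := (Submodule.mem_span_range_iff_exists_fun k).1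
    (hb ▸ Submodule.mem_top : g ∈ Submodule.span k (Set.range b))
  refine ⟨∑ i, c i • LinearMap.proj i, ?_⟩
  rw [← hc]
  ext z
  simp

theorem K0.cls_congr {X Y : FGModuleCat.{u} A} (e : X ≃ₗ[A] Y) : K0.cls X = K0.cls Y := by
  rw [K0.cls_add (Z := FGModuleCat.of A PUnit.{u + 1})
    (e.trans (LinearEquiv.prodUnique (R := A) (M := Y) (M₂ := PUnit.{u + 1})).symm),
    K0.cls_proj (FGModuleCat.of A PUnit.{u + 1})
      (inferInstanceAs (Module.Projective A PUnit.{u + 1})), add_zero]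

theorem K0.hom_ext {G : Type*} [AddCommGroup G] {f g : K0 A →ₗ[ℤ] G}
    (h : ∀ M, f (K0.cls M) = g (K0.cls M)) : f = g := by
  have : f.toAddMonoidHom.comp (QuotientAddGroup.mk' _) =
      g.toAddMonoidHom.comp (QuotientAddGroup.mk' _) := FreeAbelianGroup.lift_ext _ _ h
  ext x
  obtain ⟨x, rfl⟩ := QuotientAddGroup.mk_surjective x
  exact DFunLike.congr_fun this x

/-- The dual of Schanuel's lemma: the cokernels of two left approximations of the same module by
projective modules have the same class in `K₀`. -/
theorem K0.cls_coker_eq {F' : Type u} [AddCommGroup F'] [Module A F'] [Module.Finite A F]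
    [Module.Finite A F'] [Module.Projective A F] [Module.Projective A F'] {u : Z →ₗ[A] F}
    {u' : Z →ₗ[A] F'} (hu : IsLeftApproximation u) (hu' : IsLeftApproximation u') :
    K0.cls (FGModuleCat.of A (F ⧸ LinearMap.range u)) =
      K0.cls (FGModuleCat.of A (F' ⧸ LinearMap.range u')) := by
  obtain ⟨s, hs⟩ := hu'.exists_extend u
  obtain ⟨s', hs'⟩ := hu.exists_extend u'
  replace hs z : s (u' z) = u z := LinearMap.congr_fun hs z
  replace hs' z : s' (u z) = u' z := LinearMap.congr_fun hs' z
  -- both maps have the kernel `{(u z, -u' z)}`, so their targets are two descriptions of the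
  -- pushout of `u` and `u'`
  let p : F × F' →ₗ[A] F × (F' ⧸ LinearMap.range u') :=
    (LinearMap.fst A F F' + s ∘ₗ LinearMap.snd A F F').prod
      ((LinearMap.range u').mkQ ∘ₗ LinearMap.snd A F F')
  let p' : F × F' →ₗ[A] F' × (F ⧸ LinearMap.range u) :=
    (LinearMap.snd A F F' + s' ∘ₗ LinearMap.fst A F F').prod
      ((LinearMap.range u).mkQ ∘ₗ LinearMap.fst A F F')
  have hp : Function.Surjective p := by
    rintro ⟨x, y⟩
    obtain ⟨y, rfl⟩ := Submodule.mkQ_surjective _ y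
    exact ⟨(x - s y, y), by simp [p]⟩
  have hp' : Function.Surjective p' := by
    rintro ⟨y, x⟩
    obtain ⟨x, rfl⟩ := Submodule.mkQ_surjective _ x
    exact ⟨(x, y - s' x), by simp [p']⟩
  have hker : LinearMap.ker p = LinearMap.ker p' := by
    ext ⟨x, y⟩
    have h₁ : (x, y) ∈ LinearMap.ker p ↔ x + s y = 0 ∧ ∃ z, u' z = y := by
      simp [p, LinearMap.mem_ker, LinearMap.mem_range]
    have h₂ : (x, y) ∈ LinearMap.ker p' ↔ y + s' x = 0 ∧ ∃ z, u z = x := by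
      simp [p', LinearMap.mem_ker, LinearMap.mem_range]
    rw [h₁, h₂]
    constructor
    · rintro ⟨h, z, rfl⟩
      rw [hs] at h
      obtain rfl := eq_neg_of_add_eq_zero_left h
      exact ⟨by rw [map_neg, hs', add_neg_cancel], -z, map_neg _ _⟩
    · rintro ⟨h, z, rfl⟩
      rw [hs'] at h
      obtain rfl := eq_neg_of_add_eq_zero_left h
      exact ⟨by rw [map_neg, hs, add_neg_cancel], -z, map_neg _ _⟩
  have e : (F × (F' ⧸ LinearMap.range u')) ≃ₗ[A] F' × (F ⧸ LinearMap.range u) :=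
    (p.quotKerEquivOfSurjective hp).symm.trans
      ((Submodule.quotEquivOfEq _ _ hker).trans (p'.quotKerEquivOfSurjective hp'))
  have h₁ := K0.cls_add (X := FGModuleCat.of A (F × (F' ⧸ LinearMap.range u')))
    (Y := FGModuleCat.of A F) (Z := FGModuleCat.of A (F' ⧸ LinearMap.range u'))
    (LinearEquiv.refl A _)
  have h₂ := K0.cls_add (X := FGModuleCat.of A (F × (F' ⧸ LinearMap.range u')))
    (Y := FGModuleCat.of A F') (Z := FGModuleCat.of A (F ⧸ LinearMap.range u)) e
  rw [K0.cls_proj (FGModuleCat.of A F) ‹_›, zero_add] at h₁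
  rw [K0.cls_proj (FGModuleCat.of A F') ‹_›, zero_add] at h₂
  rw [← h₁, ← h₂]

/-- There is an endomorphism of `K₀` sending the class of a module to the class of the cokernel of
any of its left approximations by a projective module. -/
theorem exists_cosyzygyMap (k : Type u) [Field k] [Algebra k A] [Module.Finite k A] :
    ∃ C : K0 A →ₗ[ℤ] K0 A, ∀ (Z F : FGModuleCat.{u} A) (u : Z →ₗ[A] F), Module.Projective A F →
      IsLeftApproximation u → C (K0.cls Z) = K0.cls (FGModuleCat.of A (F ⧸ LinearMap.range u)) := by
  choose n u hu using exists_isLeftApproximation (A := A) k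
  let c (Z : FGModuleCat.{u} A) : K0 A :=
    K0.cls (FGModuleCat.of A ((Fin (n Z) → A) ⧸ LinearMap.range (u Z)))
  have hc {Z F : FGModuleCat.{u} A} (v : Z →ₗ[A] F) (hF : Module.Projective A F)
      (hv : IsLeftApproximation v) : c Z = K0.cls (FGModuleCat.of A (F ⧸ LinearMap.range v)) :=
    K0.cls_coker_eq (hu Z) hv
  refine ⟨(QuotientAddGroup.lift _ (FreeAbelianGroup.lift c) ?_).toIntLinearMap,
    fun Z F v hF hv => ?_⟩
  · rw [AddSubgroup.closure_le]
    rintro _ (⟨X, Y, Z, e⟩ | ⟨P, hP⟩)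
    · let v : X →ₗ[A] (Fin (n Y) → A) × (Fin (n Z) → A) := (u Y).prodMap (u Z) ∘ₗ e.toLinearMap
      have hv : IsLeftApproximation v := fun g => by
        obtain ⟨h₁, hh₁⟩ := hu Y (g ∘ₗ e.symm.toLinearMap ∘ₗ LinearMap.inl A Y Z)
        obtain ⟨h₂, hh₂⟩ := hu Z (g ∘ₗ e.symm.toLinearMap ∘ₗ LinearMap.inr A Y Z)
        refine ⟨h₁.coprod h₂, LinearMap.ext fun x => ?_⟩
        have e₁ := LinearMap.congr_fun hh₁ (e x).1
        have e₂ := LinearMap.congr_fun hh₂ (e x).2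
        simp only [LinearMap.comp_apply, LinearMap.inl_apply, LinearMap.inr_apply,
          LinearEquiv.coe_coe] at e₁ e₂
        simp only [v, LinearMap.comp_apply, LinearMap.coprod_apply, LinearMap.prodMap_apply,
          LinearEquiv.coe_coe, e₁, e₂]
        rw [← map_add, ← map_add]
        simp
      let q : (Fin (n Y) → A) × (Fin (n Z) → A) →ₗ[A]
          ((Fin (n Y) → A) ⧸ LinearMap.range (u Y)) × ((Fin (n Z) → A) ⧸ LinearMap.range (u Z)) :=
        (LinearMap.range (u Y)).mkQ.prodMap (LinearMap.range (u Z)).mkQ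
      have hq : Function.Surjective q :=
        (Submodule.mkQ_surjective _).prodMap (Submodule.mkQ_surjective _)
      have hk : LinearMap.range v = LinearMap.ker q := by
        rw [LinearMap.range_comp, LinearEquiv.range, Submodule.map_top, LinearMap.range_prodMap,
          LinearMap.ker_prodMap, Submodule.ker_mkQ, Submodule.ker_mkQ]
      have h₁ := hc (F := FGModuleCat.of A ((Fin (n Y) → A) × (Fin (n Z) → A))) v
        (inferInstanceAs (Module.Projective A ((Fin (n Y) → A) × (Fin (n Z) → A)))) hv
      have h₂ : K0.cls (FGModuleCat.of A
          (((Fin (n Y) → A) × (Fin (n Z) → A)) ⧸ LinearMap.range v)) = c Y + c Z :=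
        K0.cls_add ((Submodule.quotEquivOfEq _ _ hk).trans (q.quotKerEquivOfSurjective hq))
      simp only [SetLike.mem_coe, AddMonoidHom.mem_ker, map_sub, map_add,
        FreeAbelianGroup.lift_apply_of]
      rw [h₁, ← h₂]
      exact sub_self _
    · simp only [SetLike.mem_coe, AddMonoidHom.mem_ker, FreeAbelianGroup.lift_apply_of]
      rw [hc (F := P) LinearMap.id hP fun g => ⟨g, rfl⟩]
      refine K0.cls_proj _ ?_
      have : Subsingleton (P ⧸ LinearMap.range (LinearMap.id : P →ₗ[A] P)) := by
        rw [LinearMap.range_id]; infer_instance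
      change Module.Projective A (P ⧸ LinearMap.range (LinearMap.id : P →ₗ[A] P))
      infer_instance
  · rw [← hc v hF hv]
    simp [K0.cls]

end Approximation

section UpperBound

variable {A : Type u} [Ring A] [IsNoetherianRing A]

/-- If the inclusion of the syzygy of `Ω ^ d M` into a free cover is a left approximation for every
`M`, that is, `Ext¹(Ω ^ d M, A) = 0`, then taking cokernels of left approximations inverts `L` on
the image of `L ^ d`. Hence the ranks of `L ^ t ⟨add M⟩` are constant from `t = d` on. -/
theorem phi_le_of_isLeftApproximation (k : Type u) [Field k] [Algebra k A] [Module.Finite k A]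
    (d : ℕ) (hd : ∀ (M : FGModuleCat.{u} A) (n : ℕ) (f : (Fin n → A) →ₗ[A] (syzygy^[d] M).carrier),
      Function.Surjective f → IsLeftApproximation (LinearMap.ker f).subtype)
    (M : FGModuleCat.{u} A) : phi M ≤ d := by
  obtain ⟨C, hC⟩ := exists_cosyzygyMap (A := A) k
  have hinv : C ∘ₗ syzygyMap A ∘ₗ (syzygyMap A ^ d) = syzygyMap A ^ d := by
    refine K0.hom_ext fun X => ?_
    rw [LinearMap.comp_apply, LinearMap.comp_apply, syzygyMap_pow_cls, syzygyMap_cls]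
    obtain ⟨n, f, hf⟩ := Module.Finite.exists_fin' A (syzygy^[d] X)
    rw [K0.cls_syzygy f hf, hC _ (FGModuleCat.of A (Fin n → A)) (LinearMap.ker f).subtype
      (inferInstanceAs (Module.Projective A (Fin n → A))) (hd X n f hf)]
    exact K0.cls_congr ((Submodule.quotEquivOfEq _ _ (Submodule.range_subtype _)).trans
      (f.quotKerEquivOfSurjective hf))
  have hstep (t : ℕ) (ht : d ≤ t) : syzygyRank M t = syzygyRank M (t + 1) := by
    rw [syzygyRank, syzygyRank, pow_succ', Module.End.mul_eq_comp, Submodule.map_comp]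
    set S := (addSpan M).map (syzygyMap A ^ t) with hS
    have hCS : ∀ x ∈ S, C (syzygyMap A x) = x := by
      rintro _ ⟨y, -, rfl⟩
      obtain ⟨j, rfl⟩ := Nat.exists_eq_add_of_le ht
      rw [pow_add, Module.End.mul_apply]
      exact LinearMap.congr_fun hinv _
    have hinj : Function.Injective ((syzygyMap A).domRestrict S) := fun x y h => by
      apply Subtype.ext
      rw [← hCS x.1 x.2, ← hCS y.1 y.2]
      exact congrArg C h
    rw [← LinearMap.range_domRestrict]
    exact (LinearEquiv.ofInjective _ hinj).finrank_eq
  have hconst (j : ℕ) : syzygyRank M d = syzygyRank M (d + j) := by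
    induction j with
    | zero => rfl
    | succ j ih => rw [ih, ← add_assoc]; exact hstep _ (Nat.le_add_right _ _)
  exact Nat.sInf_le fun j _ => hconst j

end UpperBound
end Homological

/-! ### Injective dimension and vanishing of `Ext` -/

namespace Homological

section InjectiveDimension

variable {A : Type u} [Ring A]

/-- Dimension shifting in the second variable along injective modules. -/
theorem subsingleton_ext_of_cosyzygies {X E : ℕ → ModuleCat.{u} A} (f : ∀ n, X n ⟶ E n)
    (g : ∀ n, E n ⟶ X (n + 1)) (w : ∀ n, f n ≫ g n = 0)
    (hS : ∀ n, (ShortComplex.mk (f n) (g n) (w n)).ShortExact) (hE : ∀ n, Injective (E n))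
    (Z : ModuleCat.{u} A) (n m : ℕ) (h : Subsingleton (Ext.{u} Z (X 0) (m + n + 1))) :
    Subsingleton (Ext.{u} Z (X n) (m + 1)) := by
  induction n generalizing m with
  | zero => exact h
  | succ n ih =>
    have := ih (m + 1) (by rwa [show m + 1 + n + 1 = m + (n + 1) + 1 by omega])
    refine subsingleton_of_forall_eq 0 fun x => ?_
    obtain ⟨x₂, rfl⟩ := Ext.covariant_sequence_exact₃ Z (hS n) x (n₁ := m + 1 + 1) rfl
      (Subsingleton.elim _ _)
    have := hE n
    rw [Ext.eq_zero_of_injective x₂, Ext.zero_comp]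

/-- If the projective dimensions of all cosyzygies of `X 0` are bounded by `D`, then the `D`-th
cosyzygy is injective: the extension `0 → X D → E D → X (D + 1) → 0` is classified by
`Ext¹(X (D + 1), X D)`, which embeds into `Ext ^ (D + 1) (X (D + 1), X 0) = 0`. -/
theorem hasInjectiveDimensionLT_of_cosyzygies {X E : ℕ → ModuleCat.{u} A} (f : ∀ n, X n ⟶ E n)
    (g : ∀ n, E n ⟶ X (n + 1)) (w : ∀ n, f n ≫ g n = 0)
    (hS : ∀ n, (ShortComplex.mk (f n) (g n) (w n)).ShortExact) (hE : ∀ n, Injective (E n))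
    (D : ℕ) (hD : ∀ n, HasProjectiveDimensionLT (X n) (D + 1)) :
    HasInjectiveDimensionLT (X 0) (D + 1) := by
  have h₁ : Subsingleton (Ext.{u} (X (D + 1)) (X D) 1) := by
    refine subsingleton_ext_of_cosyzygies f g w hS hE _ D 0 ?_
    rw [zero_add]
    have := hD (D + 1)
    exact HasProjectiveDimensionLT.subsingleton _ (D + 1) _ le_rfl _
  have hinj : Injective (X D) := by
    obtain ⟨r, hr⟩ := Ext.contravariant_sequence_exact₁ (hS D) (X D) (Ext.mk₀ (𝟙 (X D)))
      (add_zero 1) (Subsingleton.elim _ _)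
    obtain ⟨r, rfl⟩ := Ext.homEquiv₀.symm.surjective r
    have hr : f D ≫ r = 𝟙 _ := Ext.homEquiv₀.symm.injective (by simpa using hr)
    have := hE D
    have := (⟨f D, r, hr⟩ : Retract (X D) (E D)).hasInjectiveDimensionLT 1
    exact injective_iff_hasInjectiveDimensionLT_one.2 this
  have hdown (j : ℕ) : ∀ n, n + j = D → HasInjectiveDimensionLT (X n) (j + 1) := by
    induction j with
    | zero =>
      rintro n rfl
      exact injective_iff_hasInjectiveDimensionLT_one.1 hinj
    | succ j ih =>
      intro n hn
      have := hE n
      have h₂ : HasInjectiveDimensionLT (E n) (j + 1 + 1) :=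
        hasInjectiveDimensionLT_of_ge _ 1 _ (by omega)
      exact (hS n).hasInjectiveDimensionLT_X₁ (j + 1) (ih (n + 1) (by omega)) h₂
  exact hdown D 0 (zero_add D)

/-- A finite injective dimension is bounded by the projective dimensions of the injective modules:
a nonzero class in the top degree of `Ext(M, Y)` would come from a class in `Ext(I, Y)` for an
injective module `I` containing `M`. -/
theorem subsingleton_ext_of_embeddings (d r : ℕ) (Y : ModuleCat.{u} A)
    [hY : HasInjectiveDimensionLT Y r]
    (hI : ∀ M : FGModuleCat.{u} A, ∃ (I : FGModuleCat.{u} A) (f : M →ₗ[A] I),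
      Function.Injective f ∧ HasProjectiveDimensionLT I.obj (d + 1))
    (M : FGModuleCat.{u} A) (n : ℕ) (hn : d < n) : Subsingleton (Ext.{u} M.obj Y n) := by
  suffices h : ∀ (j : ℕ) (M : FGModuleCat.{u} A) (n : ℕ), d < n → r ≤ n + j →
      Subsingleton (Ext.{u} M.obj Y n) from h r M n hn (Nat.le_add_left _ _)
  intro j
  induction j with
  | zero =>
    intro M n _ hr
    exact HasInjectiveDimensionLT.subsingleton Y r n hr _
  | succ j ih =>
    intro M n hn hr
    obtain ⟨I, f, hf, hpd⟩ := hI M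
    have hS := shortExact_moduleCatMk f (LinearMap.range f).mkQ hf (Submodule.mkQ_surjective _)
      (LinearMap.exact_iff.2 (Submodule.ker_mkQ _))
    have := ih (FGModuleCat.of A (I ⧸ LinearMap.range f)) (1 + n) (by omega) (by omega)
    refine subsingleton_of_forall_eq 0 fun x => ?_
    obtain ⟨x₂, rfl⟩ := Ext.contravariant_sequence_exact₁ hS Y x rfl (this.elim _ _)
    have : x₂ = 0 := Ext.eq_zero_of_hasProjectiveDimensionLT (X := I.obj) x₂ (d + 1) hn
    rw [this]
    exact Ext.comp_zero (C := ModuleCat.{u} A) _ _ _ _ _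

theorem exists_extend_of_subsingleton_ext {F X Y : Type u} [AddCommGroup F] [Module A F]
    [AddCommGroup X] [Module A X] [AddCommGroup Y] [Module A Y] (f : F →ₗ[A] X)
    (hf : Function.Surjective f)
    (h : Subsingleton (Ext.{u} (ModuleCat.of A X) (ModuleCat.of A Y) 1))
    (g : LinearMap.ker f →ₗ[A] Y) : ∃ g' : F →ₗ[A] Y, g' ∘ₗ (LinearMap.ker f).subtype = g := by
  have hS := LinearMap.shortExact_shortComplexKer hf
  obtain ⟨r, hr⟩ := Ext.contravariant_sequence_exact₁ hS (ModuleCat.of A Y)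
    (Ext.mk₀ (ModuleCat.ofHom g)) (add_zero 1) (h.elim _ _)
  obtain ⟨r, rfl⟩ := Ext.homEquiv₀.symm.surjective r
  have hr : ModuleCat.ofHom (LinearMap.ker f).subtype ≫ r = ModuleCat.ofHom g :=
    Ext.homEquiv₀.symm.injective (by simpa using hr)
  exact ⟨r.hom, congrArg ModuleCat.Hom.hom hr⟩

variable [IsNoetherianRing A]

theorem subsingleton_ext_iterate_syzygy (Y : ModuleCat.{u} A) (d : ℕ) (M : FGModuleCat.{u} A)
    (h : Subsingleton (Ext.{u} M.obj Y (d + 1))) :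
    Subsingleton (Ext.{u} (syzygy^[d] M).obj Y 1) := by
  induction d generalizing M with
  | zero => exact h
  | succ d ih =>
    refine ih (syzygy M) (subsingleton_of_forall_eq 0 fun x => ?_)
    have hS := LinearMap.shortExact_shortComplexKer
      (Module.Finite.exists_fin' A M).choose_spec.choose_spec
    obtain ⟨x₂, rfl⟩ := Ext.contravariant_sequence_exact₁ hS Y x (n₁ := d + 1 + 1) (by omega)
      (h.elim _ _)
    have : Projective (ModuleCat.of A (Fin (Module.Finite.exists_fin' A M).choose → A)) :=
      (IsProjective.iff_projective _).1 inferInstance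
    have : x₂ = 0 := Ext.eq_zero_of_projective x₂
    rw [this]
    exact Ext.comp_zero (C := ModuleCat.{u} A) _ _ _ _ _

end InjectiveDimension
end Homological

/-! ### Uniserial modules over a cyclic Nakayama algebra -/

namespace Nakayama

section PathAction

variable {k : Type u} [Field k] {N : ℕ}

/-- The action of a path on the uniserial representation of length `l` with top at the vertex `i`:
the basis vector `b_m` sits at the vertex `i + m` and is sent to `b_(m + length)` if the path starts
at that vertex, and to `0` otherwise. Here `b_m = 0` for `l ≤ m`. -/
def pathEnd (i : ZMod N) (l : ℕ) (p : CyclicPath N) : Module.End k (Fin l → k) where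
  toFun v m := if p.length ≤ m ∧ p.target = i + (m : ℕ) then v ⟨m - p.length, by omega⟩ else 0
  map_add' v w := by
    funext m
    simp only [Pi.add_apply]
    split_ifs <;> simp
  map_smul' c v := by
    funext m
    simp only [Pi.smul_apply, RingHom.id_apply]
    split_ifs <;> simp

theorem pathEnd_apply (i : ZMod N) (l : ℕ) (p : CyclicPath N) (v : Fin l → k) (m : Fin l) :
    pathEnd i l p v m =
      if p.length ≤ m ∧ p.target = i + (m : ℕ) then v ⟨m - p.length, by omega⟩ else 0 := rfl

theorem pathEnd_mul (i : ZMod N) (l : ℕ) (q p : CyclicPath N) :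
    (pathEnd i l q * pathEnd i l p : Module.End k (Fin l → k)) =
      if p.target = q.start then pathEnd i l ⟨p.start, p.length + q.length⟩ else 0 := by
  refine LinearMap.ext fun v => funext fun m => ?_
  rw [Module.End.mul_apply, pathEnd_apply]
  have hcast (h : q.length ≤ (m : ℕ)) (hq : q.target = i + (m : ℕ)) :
      q.start = i + ((m - q.length : ℕ) : ZMod N) := by
    rw [Nat.cast_sub h, add_sub_assoc', ← hq, CyclicPath.target, add_sub_cancel_right]
  have htgt (h : p.target = q.start) :
      (⟨p.start, p.length + q.length⟩ : CyclicPath N).target = q.target := by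
    rw [CyclicPath.target, CyclicPath.target, ← h, CyclicPath.target]
    push_cast; ring
  split_ifs with h₁ h₂ h₂
  · rw [pathEnd_apply, pathEnd_apply, htgt h₂]
    simp only [h₂, hcast h₁.1 h₁.2, h₁.2, and_true]
    split_ifs with h₃ h₄ h₄
    · congr 2; omega
    · omega
    · omega
    · rfl
  · rw [pathEnd_apply, if_neg]
    · rfl
    · rintro ⟨-, h₃⟩
      exact h₂ (h₃.trans (hcast h₁.1 h₁.2).symm)
  · rw [pathEnd_apply, if_neg]
    rw [htgt h₂]
    exact fun h => h₁ ⟨le_trans (Nat.le_add_left _ _) h.1, h.2⟩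
  · rfl

/-- The representation of the path algebra given by `pathEnd`. -/
noncomputable def pathAlgebraEnd [NeZero N] (i : ZMod N) (l : ℕ) :
    PathAlgebra k N →ₐ[k] Module.End k (Fin l → k) :=
  AlgHom.ofLinearMap ((PathAlgebra.pathBasis k N).constr k (pathEnd i l))
    (by
      rw [PathAlgebra.one_def, map_sum]
      refine LinearMap.ext fun v => funext fun m => ?_
      rw [LinearMap.sum_apply, Finset.sum_apply, Finset.sum_eq_single (i + ((m : ℕ) : ZMod N))]
      · rw [PathAlgebra.ofPath, Module.Basis.constr_basis, pathEnd_apply,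
          if_pos ⟨Nat.zero_le _, by simp [CyclicPath.target]⟩]
        rfl
      · intro j _ hj
        rw [PathAlgebra.ofPath, Module.Basis.constr_basis, pathEnd_apply, if_neg]
        rintro ⟨-, h⟩
        exact hj (by simpa [CyclicPath.target] using h)
      · exact fun h => absurd (Finset.mem_univ _) h)
    (by
      intro f g
      induction f using PathAlgebra.induction with
      | zero => rw [zero_mul, map_zero, zero_mul]
      | add a b ha hb => rw [add_mul, map_add, ha, hb, map_add, add_mul]
      | smul c a ha => rw [smul_mul_assoc, map_smul, ha, map_smul, smul_mul_assoc]
      | path q =>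
      induction g using PathAlgebra.induction with
      | zero => rw [mul_zero, map_zero, mul_zero]
      | add a b ha hb => rw [mul_add, map_add, ha, hb, map_add, mul_add]
      | smul c a ha => rw [mul_smul_comm, map_smul, ha, map_smul, mul_smul_comm]
      | path p =>
        rw [PathAlgebra.ofPath_mul_ofPath, PathAlgebra.pathMul, apply_ite
          ((PathAlgebra.pathBasis k N).constr k (pathEnd i l)), map_zero]
        simp only [PathAlgebra.ofPath, Module.Basis.constr_basis]
        exact (pathEnd_mul i l q p).symm)

theorem pathAlgebraEnd_ofPath [NeZero N] (i : ZMod N) (l : ℕ) (p : CyclicPath N) :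
    pathAlgebraEnd (k := k) i l (PathAlgebra.ofPath k p) = pathEnd i l p :=
  Module.Basis.constr_basis _ k _ _

end PathAction

section Admissible

variable {N : ℕ} (R : Relations N)

/-- The path of length `l - 1` starting at `i` contains no relation. The condition is vacuous for
`l = 0`. -/
def IsAdmissible (i : ZMod N) (l : ℕ) : Prop :=
  ∀ r ∈ R.paths, ∀ a : ℕ, a + r.length < l → r.start ≠ i + a

/-- The pairs `(i, l)` for which there is a uniserial `kQ / ⟨R⟩`-module of length `l` with top at
`i`. The value `l = 0` is allowed. -/
@[ext]
structure UniserialIndex where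
  /-- the vertex supporting the top -/
  top : ZMod N
  /-- the length of the module -/
  length : ℕ
  admissible : IsAdmissible R top length

variable {R}

theorem IsAdmissible.mono {i : ZMod N} {l l' : ℕ} (h : IsAdmissible R i l) (hl : l' ≤ l) :
    IsAdmissible R i l' := fun r hr a ha => h r hr a (ha.trans_le hl)

theorem isAdmissible_one (i : ZMod N) : IsAdmissible R i 1 := fun r hr a ha => by
  have := R.two_le_length r hr
  omega

variable (R) in
theorem exists_length_bound [NeZero N] :
    ∃ B, ∀ (i : ZMod N) (l : ℕ), IsAdmissible R i l → l < B := by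
  obtain ⟨r, hr⟩ := R.nonempty
  refine ⟨N + r.length, fun i l h => ?_⟩
  by_contra! hl
  have ha : (r.start - i).val < N := ZMod.val_lt _
  exact h r hr (r.start - i).val (by omega) (by simp)

instance [NeZero N] : Finite (UniserialIndex R) := by
  obtain ⟨B, hB⟩ := exists_length_bound R
  refine Finite.of_injective (β := ZMod N × Fin B)
    (fun x => (x.top, ⟨x.length, hB _ _ x.admissible⟩)) fun x y h => ?_
  simp only [Prod.mk.injEq, Fin.mk.injEq] at h
  exact UniserialIndex.ext h.1 h.2

/-- A uniserial module can be prolonged at the top as far as possible. -/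
theorem IsAdmissible.exists_maximal_extension [NeZero N] {i : ZMod N} {l : ℕ}
    (h : IsAdmissible R i l) : ∃ (j : ZMod N) (r : ℕ), j + r = i ∧ IsAdmissible R j (l + r) ∧
      ¬ IsAdmissible R (j - 1) (l + r + 1) := by
  obtain ⟨B, hB⟩ := exists_length_bound R
  have hex : ∃ r : ℕ, ¬ IsAdmissible R (i - r - 1) (l + r + 1) := ⟨B, fun h => by
    have := hB _ _ h
    omega⟩
  classical
  refine ⟨i - (Nat.find hex : ℕ), Nat.find hex, sub_add_cancel _ _, ?_, Nat.find_spec hex⟩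
  rcases Nat.eq_zero_or_eq_succ_pred (Nat.find hex) with h₀ | h₀
  · rw [h₀]
    simpa using h
  · have := not_not.1 (Nat.find_min hex (m := (Nat.find hex).pred) (by omega))
    rw [h₀]
    convert this using 1
    · push_cast
      ring
    · rfl

theorem exists_maximal_length [NeZero N] (i : ZMod N) :
    ∃ l, IsAdmissible R i l ∧ ¬ IsAdmissible R i (l + 1) := by
  obtain ⟨B, hB⟩ := exists_length_bound R
  by_contra! h
  have (l : ℕ) : IsAdmissible R i l := by
    induction l with
    | zero => exact (isAdmissible_one i).mono (Nat.zero_le 1)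
    | succ l ih => exact h l ih
  exact lt_irrefl _ (hB i B (this B))

end Admissible

namespace NakayamaAlgebra

variable {k : Type u} [Field k] {N : ℕ} [NeZero N] {R : Relations N}

theorem path_mul_path_of_ne {q p : CyclicPath N} (h : p.target ≠ q.start) :
    path k R q * path k R p = 0 := by
  rw [path, path, ← map_mul, PathAlgebra.ofPath_mul_ofPath, PathAlgebra.pathMul, if_neg h, map_zero]

theorem path_mul_path' (i j : ZMod N) (m n : ℕ) (h : i + m = j) :
    path k R ⟨j, n⟩ * path k R ⟨i, m⟩ = path k R ⟨i, m + n⟩ :=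
  path_mul_path k R ⟨j, n⟩ ⟨i, m⟩ h

theorem sum_path_zero : ∑ i : ZMod N, path k R ⟨i, 0⟩ = 1 := by
  rw [← map_one (RingQuot.mkAlgHom k _), PathAlgebra.one_def, map_sum]
  rfl

theorem path_eq_zero_of_not_isAdmissible {i : ZMod N} {l : ℕ} (h : ¬ IsAdmissible R i (l + 1)) :
    path k R ⟨i, l⟩ = 0 := by
  simp only [IsAdmissible, not_forall, not_not] at h
  obtain ⟨r, hr, a, ha, hs⟩ := h
  obtain ⟨b, rfl⟩ := Nat.exists_eq_add_of_le (show a + r.length ≤ l by omega)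
  rw [← path_mul_path' i (i + a + r.length) (a + r.length) b (by push_cast; ring),
    ← path_mul_path' i (i + a) a r.length rfl, ← hs, path_eq_zero k R hr, zero_mul, mul_zero]

variable {X Y : Type u} [AddCommGroup X] [Module k X] [Module (NakayamaAlgebra k R) X]
  [IsScalarTower k (NakayamaAlgebra k R) X] [AddCommGroup Y] [Module k Y]
  [Module (NakayamaAlgebra k R) Y] [IsScalarTower k (NakayamaAlgebra k R) Y]

/-- A `k`-linear map that commutes with all paths is a module homomorphism. -/
def linearMapOfPath (f : X →ₗ[k] Y) (hf : ∀ p x, f (path k R p • x) = path k R p • f x) :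
    X →ₗ[NakayamaAlgebra k R] Y where
  toFun := f
  map_add' := map_add f
  map_smul' a x := by
    obtain ⟨b, rfl⟩ := RingQuot.mkAlgHom_surjective k _ a
    rw [RingHom.id_apply]
    induction b using PathAlgebra.induction with
    | zero => rw [map_zero, zero_smul, zero_smul, map_zero]
    | add a b ha hb => rw [map_add, add_smul, map_add, ha, hb, add_smul]
    | smul c a ha => rw [map_smul (RingQuot.mkAlgHom k _), smul_assoc, f.map_smul, ha, smul_assoc]
    | path p => exact hf p x

end NakayamaAlgebra

section Uniserial

variable (k : Type u) [Field k] {N : ℕ} [NeZero N] {R : Relations N}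

/-- The uniserial module with top at the vertex `x.top` and of length `x.length`; its composition
factors sit at the vertices `x.top + m`, `m < x.length`. -/
def Uniserial (x : UniserialIndex R) : Type u := Fin x.length → k

namespace Uniserial

variable (x : UniserialIndex R)

noncomputable instance : AddCommGroup (Uniserial k x) :=
  inferInstanceAs (AddCommGroup (Fin x.length → k))

noncomputable instance : Module k (Uniserial k x) :=
  inferInstanceAs (Module k (Fin x.length → k))

instance : Module.Finite k (Uniserial k x) :=
  inferInstanceAs (Module.Finite k (Fin x.length → k))

/-- The representation of `kQ / ⟨R⟩` given by `pathEnd`. -/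
noncomputable def toEnd : NakayamaAlgebra k R →ₐ[k] Module.End k (Fin x.length → k) :=
  RingQuot.liftAlgHom k ⟨pathAlgebraEnd x.top x.length, by
    rintro _ _ ⟨⟨r, hr, rfl⟩, rfl⟩
    rw [pathAlgebraEnd_ofPath, map_zero]
    refine LinearMap.ext fun v => funext fun m => ?_
    rw [pathEnd_apply, if_neg]
    · rfl
    rintro ⟨h₁, h₂⟩
    refine x.admissible r hr (m - r.length) (by omega) ?_
    rw [Nat.cast_sub h₁, add_sub_assoc', ← h₂, CyclicPath.target, add_sub_cancel_right]⟩

noncomputable instance : Module (NakayamaAlgebra k R) (Uniserial k x) :=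
  Module.compHom (Fin x.length → k) (toEnd k x).toRingHom

theorem smul_def (a : NakayamaAlgebra k R) (v : Uniserial k x) : a • v = toEnd k x a v := rfl

instance : IsScalarTower k (NakayamaAlgebra k R) (Uniserial k x) :=
  ⟨fun c a v => by
    rw [smul_def, map_smul]
    rfl⟩

instance : Module.Finite (NakayamaAlgebra k R) (Uniserial k x) :=
  Module.Finite.of_restrictScalars_finite k _ _

variable {k x}

theorem path_smul_apply (p : CyclicPath N) (v : Uniserial k x) (m : Fin x.length) :
    (NakayamaAlgebra.path k R p • v) m =
      if p.length ≤ m ∧ p.target = x.top + (m : ℕ) then v ⟨m - p.length, by omega⟩ else 0 := by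
  rw [smul_def, toEnd, NakayamaAlgebra.path, RingQuot.liftAlgHom_mkAlgHom_apply,
    pathAlgebraEnd_ofPath]
  rfl

end Uniserial

end Uniserial

end Nakayama

/-! ### Homomorphisms between uniserial modules -/

namespace Nakayama

namespace Uniserial

open NakayamaAlgebra

variable {k : Type u} [Field k] {N : ℕ} [NeZero N] {R : Relations N}

variable (k) in
/-- The basis vector of a uniserial module at the vertex `x.top + m`. -/
noncomputable def single (x : UniserialIndex R) (m : Fin x.length) : Uniserial k x :=
  (Pi.single m 1 : Fin x.length → k)

omit [NeZero N] in
theorem eq_sum_single {x : UniserialIndex R} (v : Uniserial k x) :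
    v = ∑ m, v m • single k x m := by
  have := (LinearMap.pi_apply_eq_sum_univ (LinearMap.id : (Fin x.length → k) →ₗ[k] _) v)
  refine this.trans (Finset.sum_congr rfl fun m _ => congrArg (v m • ·) (funext fun j => ?_))
  simp [single, Pi.single_apply, eq_comm]

omit [NeZero N] in
theorem linearMap_ext {x : UniserialIndex R} {Y : Type u} [AddCommGroup Y] [Module k Y]
    {f g : Uniserial k x →ₗ[k] Y} (h : ∀ m, f (single k x m) = g (single k x m)) : f = g := by
  ext v
  rw [eq_sum_single v, map_sum, map_sum]
  simp only [map_smul, h]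

theorem path_smul_single (p : CyclicPath N) (x : UniserialIndex R) (m : Fin x.length) :
    path k R p • single k x m = if h : p.start = x.top + (m : ℕ) ∧ m + p.length < x.length then
      single k x ⟨m + p.length, h.2⟩ else 0 := by
  funext n
  rw [path_smul_apply]
  by_cases hn : p.length ≤ n ∧ (n : ℕ) - p.length = m
  · have hn' : (n : ℕ) = m + p.length := by omega
    have h₁ : p.target = x.top + (n : ℕ) ↔ p.start = x.top + (m : ℕ) := by
      rw [hn', CyclicPath.target]
      push_cast
      rw [← add_assoc, add_left_inj]
    by_cases h₂ : p.start = x.top + (m : ℕ)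
    · rw [if_pos ⟨hn.1, h₁.2 h₂⟩, dif_pos ⟨h₂, by omega⟩]
      have e₁ : (⟨n - p.length, by omega⟩ : Fin x.length) = m := Fin.ext hn.2
      have e₂ : (⟨m + p.length, by omega⟩ : Fin x.length) = n := Fin.ext hn'.symm
      rw [e₁, e₂, single, single, Pi.single_eq_same, Pi.single_eq_same]
    · rw [if_neg (fun h => h₂ (h₁.1 h.2)), dif_neg (fun h => h₂ h.1)]
      rfl
  · have hr : (if h : p.start = x.top + (m : ℕ) ∧ m + p.length < x.length then
      single k x ⟨m + p.length, h.2⟩ else 0) n = 0 := by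
      split_ifs with h
      · refine Pi.single_eq_of_ne (fun he => hn ?_) _
        rw [he]
        constructor
        · simp
        · simp
      · rfl
    rw [hr]
    split_ifs with h
    · refine Pi.single_eq_of_ne (fun he => hn ⟨h.1, ?_⟩) _
      rw [← he]
    · rfl

/-- Homomorphisms out of a uniserial module: the generator can be sent to any element annihilated
by the path of length `x.length` starting at `x.top`. -/
theorem exists_hom (x : UniserialIndex R) {Y : Type u} [AddCommGroup Y] [Module k Y]
    [Module (NakayamaAlgebra k R) Y] [IsScalarTower k (NakayamaAlgebra k R) Y] (y : Y)
    (hy : path k R ⟨x.top, x.length⟩ • y = 0) :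
    ∃ f : Uniserial k x →ₗ[NakayamaAlgebra k R] Y,
      ∀ m, f (single k x m) = path k R ⟨x.top, m⟩ • y := by
  let f₀ : Uniserial k x →ₗ[k] Y :=
    { toFun := fun v => ∑ m, v m • path k R ⟨x.top, m⟩ • y
      map_add' := fun v w => by
        rw [← Finset.sum_add_distrib]
        exact Finset.sum_congr rfl fun m _ => add_smul _ _ _
      map_smul' := fun c v => by
        rw [RingHom.id_apply, Finset.smul_sum]
        exact Finset.sum_congr rfl fun m _ => mul_smul _ _ _ }
  have hf₀ (m : Fin x.length) : f₀ (single k x m) = path k R ⟨x.top, m⟩ • y := by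
    change ∑ n, single k x m n • path k R ⟨x.top, n⟩ • y = _
    rw [Finset.sum_eq_single m]
    · rw [single, Pi.single_eq_same, one_smul]
    · intro n _ hn
      rw [single, Pi.single_eq_of_ne hn, zero_smul]
    · exact fun h => absurd (Finset.mem_univ _) h
  refine ⟨linearMapOfPath f₀ fun p v => ?_, hf₀⟩
  rw [eq_sum_single v, Finset.smul_sum, map_sum, map_sum, Finset.smul_sum]
  refine Finset.sum_congr rfl fun m _ => ?_
  rw [smul_comm (path k R p) (v m), f₀.map_smul, f₀.map_smul, smul_comm (path k R p) (v m), hf₀,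
    path_smul_single, ← mul_smul (path k R p)]
  congr 1
  split_ifs with h
  · rw [hf₀, path_mul_path k R p ⟨x.top, m⟩ h.1.symm]
  · rw [map_zero]
    by_cases h₁ : p.start = x.top + (m : ℕ)
    · rw [path_mul_path k R p ⟨x.top, m⟩ h₁.symm]
      obtain ⟨b, hb⟩ := Nat.exists_eq_add_of_le (show x.length ≤ m + p.length by
        by_contra hlt
        exact h ⟨h₁, by omega⟩)
      simp only [hb]
      rw [← path_mul_path' x.top _ x.length b rfl, mul_smul, hy, smul_zero]
    · rw [path_mul_path_of_ne fun h₂ => h₁ h₂.symm, zero_smul]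

/-- Homomorphisms into a uniserial module that cannot be prolonged at the top: every linear
functional on `Y` is the last coordinate of one, up to restriction to the vertex of the socle. -/
theorem exists_cohom (x : UniserialIndex R) (hx : path k R ⟨x.top - 1, x.length⟩ = 0) {Y : Type u}
    [AddCommGroup Y] [Module k Y] [Module (NakayamaAlgebra k R) Y]
    [IsScalarTower k (NakayamaAlgebra k R) Y] (μ : Y →ₗ[k] k) :
    ∃ f : Y →ₗ[NakayamaAlgebra k R] Uniserial k x,
      ∀ y m, f y m = μ (path k R ⟨x.top + (m : ℕ), x.length - 1 - m⟩ • y) := by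
  have hl (a : NakayamaAlgebra k R) (c : k) (y : Y) : a • c • y = c • a • y := smul_comm _ _ _
  let f₀ : Y →ₗ[k] Uniserial k x :=
    { toFun := fun y m => μ (path k R ⟨x.top + (m : ℕ), x.length - 1 - m⟩ • y)
      map_add' := fun y z => funext fun m => by
        rw [smul_add, map_add]
        rfl
      map_smul' := fun c y => funext fun m => by
        rw [hl, map_smul]
        rfl }
  refine ⟨linearMapOfPath f₀ fun p y => funext fun m => ?_, fun _ _ => rfl⟩
  rw [path_smul_apply]
  change μ (path k R ⟨x.top + (m : ℕ), x.length - 1 - m⟩ • path k R p • y) = _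
  rw [← mul_smul]
  have hm := m.2
  by_cases h : p.target = x.top + (m : ℕ)
  · rw [path_mul_path k R ⟨x.top + (m : ℕ), x.length - 1 - m⟩ p h]
    by_cases h₁ : p.length ≤ m
    · rw [if_pos ⟨h₁, h⟩]
      change _ = μ (path k R ⟨x.top + ((m - p.length : ℕ) : ZMod N), _⟩ • y)
      congr 4
      · rw [Nat.cast_sub h₁, add_sub_assoc', ← h, CyclicPath.target, add_sub_cancel_right]
      · change _ = x.length - 1 - (m - p.length)
        change p.length + (x.length - 1 - m) = _
        omega
    · rw [if_neg fun h₂ => h₁ h₂.1]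
      obtain ⟨b, hb⟩ := Nat.exists_eq_add_of_le (show (m : ℕ) + 1 ≤ p.length by omega)
      have hlen : p.length + (x.length - 1 - m) = b + x.length := by omega
      have hs : p.start + b = x.top - 1 := by
        rw [CyclicPath.target, hb] at h
        push_cast at h
        linear_combination h
      rw [hlen, ← path_mul_path' p.start _ b x.length hs, hx, zero_mul, zero_smul, map_zero]
  · rw [if_neg fun h₂ => h h₂.2, path_mul_path_of_ne h, zero_smul, map_zero]

/-- Uniserial modules of maximal length at their top are projective. -/
theorem projective (x : UniserialIndex R) (hx : path k R ⟨x.top, x.length⟩ = 0) :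
    Module.Projective (NakayamaAlgebra k R) (Uniserial k x) := by
  rcases Nat.eq_zero_or_pos x.length with h₀ | h₀
  · have : Subsingleton (Uniserial k x) := ⟨fun v w => funext fun m => by
      have := m.2
      omega⟩
    infer_instance
  obtain ⟨s, hs⟩ := exists_hom (k := k) x (1 : NakayamaAlgebra k R) (by rw [hx, zero_smul])
  refine Module.Projective.of_split s
    (LinearMap.toSpanSingleton (NakayamaAlgebra k R) _ (single k x ⟨0, h₀⟩)) ?_
  suffices h : (LinearMap.toSpanSingleton (NakayamaAlgebra k R) _ (single k x ⟨0, h₀⟩) ∘ₗ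
      s).restrictScalars k = LinearMap.id from LinearMap.ext fun v => LinearMap.congr_fun h v
  refine linearMap_ext fun m => ?_
  rw [LinearMap.restrictScalars_apply, LinearMap.comp_apply, hs, LinearMap.toSpanSingleton_apply,
    smul_eq_mul, mul_one, path_smul_single, dif_pos (by simp)]
  simp

/-- Uniserial modules that cannot be prolonged at the top are injective: they are the duals of the
indecomposable projective right modules. -/
theorem injective (x : UniserialIndex R) (hx : path k R ⟨x.top - 1, x.length⟩ = 0) :
    Module.Injective (NakayamaAlgebra k R) (Uniserial k x) := by
  refine ⟨fun X Y _ _ _ _ f hf g => ?_⟩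
  rcases Nat.eq_zero_or_pos x.length with h₀ | h₀
  · exact ⟨0, fun y => funext fun m => by
      have := m.2
      omega⟩
  let _ : Module k X := Module.compHom X (algebraMap k (NakayamaAlgebra k R))
  have : IsScalarTower k (NakayamaAlgebra k R) X := ⟨fun c a x => by
    rw [Algebra.smul_def, mul_smul]; rfl⟩
  let _ : Module k Y := Module.compHom Y (algebraMap k (NakayamaAlgebra k R))
  have : IsScalarTower k (NakayamaAlgebra k R) Y := ⟨fun c a x => by
    rw [Algebra.smul_def, mul_smul]; rfl⟩
  -- a homomorphism to `Uniserial k x` is determined by its last coordinate, a linear functional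
  let last : Uniserial k x →ₗ[k] k :=
    (LinearMap.proj ⟨x.length - 1, by omega⟩ : (Fin x.length → k) →ₗ[k] k)
  obtain ⟨p, hp⟩ := (f.restrictScalars k).exists_leftInverse_of_injective
    (LinearMap.ker_eq_bot.2 hf)
  obtain ⟨h, hh⟩ := exists_cohom x hx ((last ∘ₗ g.restrictScalars k) ∘ₗ p)
  refine ⟨h, fun z => funext fun m => ?_⟩
  have hm := m.2
  have hpz : p (f (path k R ⟨x.top + (m : ℕ), x.length - 1 - m⟩ • z)) =
      path k R ⟨x.top + (m : ℕ), x.length - 1 - m⟩ • z := LinearMap.congr_fun hp _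
  rw [hh, ← map_smul, LinearMap.comp_apply, hpz, LinearMap.comp_apply,
    LinearMap.restrictScalars_apply, map_smul]
  change (path k R _ • g z) (⟨x.length - 1, by omega⟩ : Fin x.length) = _
  rw [path_smul_apply, if_pos]
  · refine congrArg (g z) (Fin.ext ?_)
    change x.length - 1 - (x.length - 1 - m) = m
    omega
  · refine ⟨by simp, ?_⟩
    rw [CyclicPath.target, add_assoc, ← Nat.cast_add]
    congr 2
    change (m : ℕ) + (x.length - 1 - m) = x.length - 1
    omega

/-- A uniserial module `U` embeds into each of its prolongations `U'` at the top, and the cokernel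
is again uniserial. -/
theorem exists_shortExact (x y z : UniserialIndex R) (r : ℕ) (hxy : y.top + r = x.top)
    (hzy : z.top = y.top) (hy : y.length = x.length + r) (hz : z.length = r) :
    ∃ (f : Uniserial k x →ₗ[NakayamaAlgebra k R] Uniserial k y)
      (g : Uniserial k y →ₗ[NakayamaAlgebra k R] Uniserial k z),
      Function.Injective f ∧ Function.Surjective g ∧ Function.Exact f g := by
  let f₀ : Uniserial k x →ₗ[k] Uniserial k y :=
    { toFun := fun v m => if h : r ≤ m then v ⟨m - r, by omega⟩ else 0
      map_add' := fun v w => funext fun m => by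
        change (if h : r ≤ (m : ℕ) then v ⟨m - r, by omega⟩ + w ⟨m - r, by omega⟩ else 0) =
          (if h : r ≤ (m : ℕ) then v ⟨m - r, by omega⟩ else 0) +
            (if h : r ≤ (m : ℕ) then w ⟨m - r, by omega⟩ else 0)
        split_ifs
        · rfl
        · rw [add_zero]
      map_smul' := fun c v => funext fun m => by
        change (if h : r ≤ (m : ℕ) then c * v ⟨m - r, by omega⟩ else 0) =
          c * (if h : r ≤ (m : ℕ) then v ⟨m - r, by omega⟩ else 0)
        split_ifs
        · rfl
        · rw [mul_zero] }
  let g₀ : Uniserial k y →ₗ[k] Uniserial k z :=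
    { toFun := fun v m => v ⟨m, by omega⟩
      map_add' := fun _ _ => rfl
      map_smul' := fun _ _ => rfl }
  have hf₀ (v : Uniserial k x) (m : Fin y.length) :
      f₀ v m = if h : r ≤ m then v ⟨m - r, by omega⟩ else 0 := rfl
  have hg₀ (v : Uniserial k y) (m : Fin z.length) : g₀ v m = v ⟨m, by omega⟩ := rfl
  refine ⟨linearMapOfPath f₀ fun p v => funext fun m => ?_,
    linearMapOfPath g₀ fun p v => funext fun m => ?_, ?_, ?_, ?_⟩
  · rw [hf₀, path_smul_apply, hf₀]
    split_ifs with h₁ h₂ h₃ h₂ h₃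
    · rw [path_smul_apply, if_pos]
      · congr 1
        apply Fin.ext
        change (m : ℕ) - r - p.length = m - p.length - r
        omega
      · refine ⟨by change p.length ≤ m - r; change r ≤ m - p.length at h₃; omega, ?_⟩
        rw [h₂.2, ← hxy, add_assoc, ← Nat.cast_add]
        congr 2
        change (m : ℕ) = r + (m - r)
        omega
    · rw [path_smul_apply, if_neg]
      rintro ⟨h₄, -⟩
      change p.length ≤ m - r at h₄
      change ¬ r ≤ m - p.length at h₃
      omega
    · rw [path_smul_apply, if_neg]
      rintro ⟨h₄, h₅⟩
      change p.length ≤ m - r at h₄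
      refine h₂ ⟨by omega, ?_⟩
      rw [h₅, ← hxy, add_assoc, ← Nat.cast_add]
      congr 2
      change r + (m - r) = (m : ℕ)
      omega
    · change r ≤ m - p.length at h₃
      omega
    · rfl
    · rfl
  · rw [hg₀, path_smul_apply, path_smul_apply, hzy]
    rfl
  · intro v w h
    funext m
    have := congrFun h ⟨m + r, by omega⟩
    change f₀ v _ = f₀ w _ at this
    rw [hf₀, hf₀, dif_pos (Nat.le_add_left _ _), dif_pos (Nat.le_add_left _ _)] at this
    simpa using this
  · intro v
    refine ⟨fun m => if h : (m : ℕ) < r then v ⟨m, by omega⟩ else 0, funext fun m => ?_⟩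
    change dite _ _ _ = _
    rw [dif_pos]
    have := m.2
    change (m : ℕ) < r
    omega
  · intro v
    constructor
    · intro h
      refine ⟨fun m => v ⟨m + r, by omega⟩, funext fun m => ?_⟩
      change dite _ _ _ = _
      split_ifs with h₁
      · change v ⟨m - r + r, _⟩ = v m
        congr 1
        apply Fin.ext
        exact Nat.sub_add_cancel h₁
      · exact (congrFun h ⟨m, by omega⟩).symm
    · rintro ⟨w, rfl⟩
      funext m
      change dite _ _ _ = _
      rw [dif_neg]
      · rfl
      · have := m.2
        change ¬ r ≤ (m : ℕ)
        omega

end Uniserial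

end Nakayama

/-! ### Gorenstein cyclic Nakayama algebras -/

namespace Nakayama

open NakayamaAlgebra Homological

section Gorenstein

variable {k : Type u} [Field k] {N : ℕ} [NeZero N] {R : Relations N}

variable (k) in
/-- A uniserial module `U` has a cosyzygy that is again uniserial. -/
theorem Uniserial.exists_cosyzygy (x : UniserialIndex R) :
    ∃ (y z : UniserialIndex R) (f : Uniserial k x →ₗ[NakayamaAlgebra k R] Uniserial k y)
      (g : Uniserial k y →ₗ[NakayamaAlgebra k R] Uniserial k z),
      Module.Injective (NakayamaAlgebra k R) (Uniserial k y) ∧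
        Function.Injective f ∧ Function.Surjective g ∧ Function.Exact f g := by
  obtain ⟨j, r, hj, hadm, hmax⟩ := x.admissible.exists_maximal_extension
  let y : UniserialIndex R := ⟨j, x.length + r, hadm⟩
  let z : UniserialIndex R := ⟨j, r, hadm.mono (Nat.le_add_left _ _)⟩
  obtain ⟨f, g, h⟩ := Uniserial.exists_shortExact (k := k) x y z r hj rfl rfl rfl
  exact ⟨y, z, f, g, Uniserial.injective y (path_eq_zero_of_not_isAdmissible hmax), h⟩

/-- Over a Gorenstein cyclic Nakayama algebra the uniserial projective modules have finite injective
dimension: their iterated cosyzygies have finite projective dimension, which is bounded because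
there are only finitely many uniserial modules. -/
theorem Uniserial.exists_hasInjectiveDimensionLT (hG : IsGorenstein (NakayamaAlgebra k R))
    (x : UniserialIndex R) (hx : Module.Projective (NakayamaAlgebra k R) (Uniserial k x)) :
    ∃ r, HasInjectiveDimensionLT (ModuleCat.of (NakayamaAlgebra k R) (Uniserial k x)) r := by
  choose y z f g hy hf hg hfg using Uniserial.exists_cosyzygy (R := R) k
  let U (x : UniserialIndex R) := ModuleCat.of (NakayamaAlgebra k R) (Uniserial k x)
  let Φ (x : UniserialIndex R) : U x ⟶ U (y x) := ModuleCat.ofHom (f x)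
  let Ψ (x : UniserialIndex R) : U (y x) ⟶ U (z x) := ModuleCat.ofHom (g x)
  have hS (x) := shortExact_moduleCatMk (f x) (g x) (hf x) (hg x) (hfg x)
  -- the iterated cosyzygies of `x`
  let w (n : ℕ) : UniserialIndex R := Nat.rec x (fun _ v => z v) n
  have hfin (n : ℕ) : ∃ m, HasProjectiveDimensionLT (U (w n)) m := by
    induction n with
    | zero => exact ⟨1, (hasProjectiveDimensionLT_one_iff _).2 hx⟩
    | succ n ih =>
      obtain ⟨m, hm⟩ := ih
      obtain ⟨m', hm'⟩ := (projectiveDimension_ne_top_iff _).1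
        (hG (FGModuleCat.of _ (Uniserial k (y (w n)))) (hy _))
      have h₁ : HasProjectiveDimensionLT (U (w n)) (m + m') :=
        hasProjectiveDimensionLT_of_ge _ m _ (Nat.le_add_right _ _)
      have h₂ : HasProjectiveDimensionLT (U (y (w n))) (m + m' + 1) :=
        hasProjectiveDimensionLT_of_ge _ (m' + 1) _ (by omega)
      exact ⟨m + m' + 1, (hS (w n)).hasProjectiveDimensionLT_X₃ (m + m') h₁ h₂⟩
  obtain ⟨D, hD⟩ : ∃ D, ∀ v : UniserialIndex R, (∃ m, HasProjectiveDimensionLT (U v) m) →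
      HasProjectiveDimensionLT (U v) D := by
    have h (w : UniserialIndex R) : ∃ m, (∃ m, HasProjectiveDimensionLT (U w) m) →
        HasProjectiveDimensionLT (U w) m := by
      by_cases hw : ∃ m, HasProjectiveDimensionLT (U w) m
      · exact ⟨hw.choose, fun _ => hw.choose_spec⟩
      · exact ⟨0, fun h => absurd h hw⟩
    choose b hb using h
    obtain ⟨D, hD⟩ := Finite.exists_le b
    exact ⟨D, fun w hw => by
      have := hb w hw
      exact hasProjectiveDimensionLT_of_ge _ (b w) D (hD w)⟩
  refine ⟨D + 1, hasInjectiveDimensionLT_of_cosyzygies (X := fun n => U (w n))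
    (E := fun n => U (y (w n))) (fun n => Φ (w n)) (fun n => Ψ (w n)) _
    (fun n => hS (w n))
    (fun n => (Module.injective_iff_injective_object _ (Uniserial k (y (w n)))).1 (hy _)) D
    fun n => ?_⟩
  have := hD _ (hfin n)
  exact hasProjectiveDimensionLT_of_ge _ D _ (Nat.le_succ _)

variable (R) in
/-- Every vertex supports the socle of an injective uniserial module. -/
theorem exists_injective_index (k : Type u) [Field k] (i : ZMod N) : ∃ x : UniserialIndex R,
    path k R ⟨x.top - 1, x.length⟩ = 0 ∧ 0 < x.length ∧
      x.top + ((x.length - 1 : ℕ) : ZMod N) = i := by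
  obtain ⟨j, r, hj, hadm, hmax⟩ := (isAdmissible_one (R := R) i).exists_maximal_extension
  refine ⟨⟨j, 1 + r, hadm⟩, path_eq_zero_of_not_isAdmissible hmax, by simp, ?_⟩
  simpa using hj

/-- Every finitely generated module embeds into a finite product of injective uniserial modules. -/
theorem exists_injective_embedding (M : FGModuleCat.{u} (NakayamaAlgebra k R)) :
    ∃ (I : FGModuleCat.{u} (NakayamaAlgebra k R)) (f : M →ₗ[NakayamaAlgebra k R] I),
      Module.Injective (NakayamaAlgebra k R) I ∧ Function.Injective f := by
  let _ : Module k M := Module.compHom M (algebraMap k (NakayamaAlgebra k R))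
  have : IsScalarTower k (NakayamaAlgebra k R) M := ⟨fun c a x => by
    rw [Algebra.smul_def, mul_smul]; rfl⟩
  have : Module.Finite k M := Module.Finite.trans (NakayamaAlgebra k R) M
  choose x hx hpos hsoc using exists_injective_index (R := R) k
  let b := Module.finBasis k M
  choose f hf using fun (i : ZMod N) (j : Fin (Module.finrank k M)) =>
    Uniserial.exists_cohom (x i) (hx i) (b.coord j)
  have hinj (i : ZMod N) := Uniserial.injective (x i) (hx i)
  let I (q : ZMod N × Fin (Module.finrank k M)) := Uniserial k (x q.1)
  have : ∀ q, Module.Injective (NakayamaAlgebra k R) (I q) := fun q => hinj q.1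
  refine ⟨FGModuleCat.of _ (∀ q, I q), LinearMap.pi fun q => f q.1 q.2,
    Module.Injective.pi (NakayamaAlgebra k R) I, ?_⟩
  refine (injective_iff_map_eq_zero _).2 fun y hy => ?_
  have hvert (i : ZMod N) : path k R ⟨i, 0⟩ • y = 0 := by
    refine b.ext_elem fun j => ?_
    have h := congrFun (congrFun hy (i, j)) ⟨(x i).length - 1, Nat.sub_one_lt (hpos i).ne'⟩
    change f i j y _ = 0 at h
    rw [hf] at h
    simp only [hsoc, Nat.sub_self] at h
    rw [map_zero]
    exact h
  rw [← one_smul (NakayamaAlgebra k R) y, ← sum_path_zero, Finset.sum_smul]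
  exact Finset.sum_eq_zero fun i _ => hvert i

variable (k R) in
/-- The regular module is a direct summand of a product of projective uniserial modules. -/
theorem exists_retract_pi : ∃ (x : ZMod N → UniserialIndex R)
    (p : (∀ i, Uniserial k (x i)) →ₗ[NakayamaAlgebra k R] NakayamaAlgebra k R)
    (s : NakayamaAlgebra k R →ₗ[NakayamaAlgebra k R] ∀ i, Uniserial k (x i)),
    p ∘ₗ s = LinearMap.id ∧
      ∀ i, Module.Projective (NakayamaAlgebra k R) (Uniserial k (x i)) := by
  choose l hl hmax using exists_maximal_length (R := R)
  let x (i : ZMod N) : UniserialIndex R := ⟨i, l i, hl i⟩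
  have hx (i : ZMod N) : path k R ⟨(x i).top, (x i).length⟩ = 0 :=
    path_eq_zero_of_not_isAdmissible (hmax i)
  choose f hf using fun i => Uniserial.exists_hom (k := k) (x i) (1 : NakayamaAlgebra k R)
    (by rw [hx, zero_smul])
  have hpos (i : ZMod N) : 0 < (x i).length := by
    by_contra h
    have h₀ : l i = 0 := by
      change ¬ 0 < l i at h
      omega
    have := hmax i
    rw [h₀] at this
    exact this (isAdmissible_one i)
  let p : (∀ i, Uniserial k (x i)) →ₗ[NakayamaAlgebra k R] NakayamaAlgebra k R :=
    ∑ i, f i ∘ₗ LinearMap.proj i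
  have hp : Function.Surjective p := fun a => by
    refine ⟨a • fun i => Uniserial.single k (x i) ⟨0, hpos i⟩, ?_⟩
    rw [map_smul, LinearMap.sum_apply]
    simp only [LinearMap.comp_apply, LinearMap.proj_apply, hf, smul_eq_mul, mul_one]
    change a * ∑ i, path k R ⟨i, 0⟩ = a
    rw [sum_path_zero, mul_one]
  obtain ⟨s, hs⟩ := Module.projective_lifting_property p LinearMap.id hp
  exact ⟨x, p, s, hs, fun i => Uniserial.projective (x i) (hx i)⟩

/-- If all finitely generated injective modules have projective dimension at most `d`, then
`Ext¹(Ω ^ d M, A) = 0` for every `M`, so `φ(M) ≤ d`. -/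
theorem phi_le_of_injective (hG : IsGorenstein (NakayamaAlgebra k R)) (d : ℕ)
    (hd : ∀ I : FGModuleCat.{u} (NakayamaAlgebra k R), Module.Injective (NakayamaAlgebra k R) I →
      HasProjectiveDimensionLT I.obj (d + 1))
    (M : FGModuleCat.{u} (NakayamaAlgebra k R)) : phi M ≤ d := by
  refine phi_le_of_isLeftApproximation k d (fun M n f hf g => ?_) M
  obtain ⟨x, p, s, hps, hx⟩ := exists_retract_pi k R
  have hext (i : ZMod N) : ∃ h : (Fin n → NakayamaAlgebra k R) →ₗ[NakayamaAlgebra k R]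
      Uniserial k (x i), h ∘ₗ (LinearMap.ker f).subtype = LinearMap.proj i ∘ₗ s ∘ₗ g := by
    obtain ⟨r, hr⟩ := Uniserial.exists_hasInjectiveDimensionLT hG (x i) (hx i)
    refine exists_extend_of_subsingleton_ext f hf ?_ _
    refine subsingleton_ext_iterate_syzygy _ d M ?_
    refine subsingleton_ext_of_embeddings d r _ (fun M => ?_) M (d + 1) (Nat.lt_succ_self d)
    obtain ⟨I, f, hI, hf⟩ := exists_injective_embedding M
    exact ⟨I, f, hf, hd I hI⟩
  choose h hh using hext
  refine ⟨p ∘ₗ LinearMap.pi h, LinearMap.ext fun z => ?_⟩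
  have hz : LinearMap.pi h z.1 = s (g z) := funext fun i => LinearMap.congr_fun (hh i) z
  change p (LinearMap.pi h z.1) = g z
  rw [hz]
  exact LinearMap.congr_fun hps (g z)

end Gorenstein

end Nakayama

theorem mainTheorem2 {k : Type u} [Field k] {N : ℕ} [NeZero N] (hN : 2 ≤ N)
    (R : Nakayama.Relations N) (hG : Homological.IsGorenstein (Nakayama.NakayamaAlgebra k R)) :
    Homological.gorDim (Nakayama.NakayamaAlgebra k R) =
      (Homological.phiDim (Nakayama.NakayamaAlgebra k R) : WithBot ℕ∞) := by
  apply le_antisymm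
  · exact iSup₂_le fun I hI => Homological.projectiveDimension_le_phiDim (k := k) I (hG I hI)
  · have hle (I : FGModuleCat.{u} (Nakayama.NakayamaAlgebra k R))
        (hI : Module.Injective (Nakayama.NakayamaAlgebra k R) I) :
        projectiveDimension I.obj ≤ Homological.gorDim (Nakayama.NakayamaAlgebra k R) :=
      le_iSup₂ (f := fun (I : FGModuleCat.{u} (Nakayama.NakayamaAlgebra k R))
        (_ : Module.Injective (Nakayama.NakayamaAlgebra k R) I) =>
          projectiveDimension I.obj) I hI
    generalize Homological.gorDim (Nakayama.NakayamaAlgebra k R) = e at hle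
    induction e with
    | bot =>
      -- a nonzero injective module exists, so the Gorenstein dimension is not `⊥`
      obtain ⟨x, hx, hpos, -⟩ := Nakayama.exists_injective_index R k 0
      have h := hle (FGModuleCat.of _ (Nakayama.Uniserial k x)) (Nakayama.Uniserial.injective x hx)
      rw [le_bot_iff, projectiveDimension_eq_bot_iff] at h
      have hs : Subsingleton (Nakayama.Uniserial k x) := ModuleCat.subsingleton_of_isZero h
      have h₀ := congrFun (hs.elim (Nakayama.Uniserial.single k x ⟨0, hpos⟩) 0) ⟨0, hpos⟩
      rw [Nakayama.Uniserial.single, Pi.single_eq_same] at h₀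
      exact absurd h₀ one_ne_zero
    | coe e =>
      rw [WithBot.coe_le_coe]
      induction e with
      | top => exact le_top
      | coe d =>
        refine iSup_le fun M => Nat.cast_le.2 (Nakayama.phi_le_of_injective hG d (fun I hI => ?_) M)
        exact (projectiveDimension_le_iff _ _).1 (hle I hI)
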